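/- Let $L,M\ge 1$, let $A\in\mathbb R^{L\times M}$ have full rank $r=\min\{L,M\}$, let $\sigma>0$, let $X\sim\mathcal N(0,I_M)$, $W\sim\mathcal N(0,\sigma^2 I_L)$ be independent and $Y=AX+W$. Write $\lambda_l(C)$ for the $l$-th largest eigenvalue (with multiplicity) of a symmetric matrix $C$, and put $\lambda_l=\lambda_l(AA^T)$, $l\in[L]$, $\Sigma_Y=AA^T+\sigma^2 I$, $\Sigma_{X|Y}=A^T(AA^T+\sigma^2 I)^{-1}A$. For a positive semidefinite $C$ put $R_1(C)=0$, $R_k(C)=\frac12\sum_{l=1}^k\log_2\frac{\lambda_l(C)}{\lambda_k(C)}$ for $2\le k\le \operatorname{rank} C$, $R_{\operatorname{rank}C+1}(C)=\infty$, and $\theta_k(C,R)=2^{-2R/k}\bigl(\prod_{l=1}^k\lambda_l(C)\bigr)^{1/k}$. The iDRF is $D_{X|Y}(R)=\inf \frac1M\mathbb E\|X-\widehat X\|^2$, the infimum over all joint laws of $(Y,\widehat X)$ (with $X - Y - \widehat X$ a Markov chain) whose mutual information satisfies $I(Y;\widehat X)\le R$ bits. The CE-DRF is $D_{CE}(R)=\inf_g\frac1M\mathbb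 E\|X-g(\widehat Y)\|^2=\frac1M\mathbb E\|X-\mathbb E[X|\widehat Y]\|^2$, where $X - Y - \widehat Y$ is a Markov chain and $Y=\widehat Y+N$ with independent Gaussian $\widehat Y\sim\mathcal N(0,\Sigma_Y-\Sigma_N)$, $N\sim\mathcal N(0,\Sigma_N)$, $\Sigma_N=U\operatorname{diag}(\min(\lambda_l(\Sigma_Y),\theta))U^T$, $U$ orthogonal diagonalizing $\Sigma_Y$ (with the eigenvalues in matching order), and $\theta>0$ chosen so that $\sum_{l=1}^L\frac12\log_2\max\{1,\lambda_l(\Sigma_Y)/\theta\}=R$. Let $c=\lambda_1/(\lambda_1+\sigma^2)^2$, and let $r_0$ be the largest $k\in[L]$ such that $\lambda_l/(\lambda_l+\sigma^2)^2=c$ for all $l\le k$; here, for every $k\in[L]$, $\lambda_k/(\lambda_k+\sigma^2)^2=c$ if and only if $\lambda_k=\frac{1-2c\sigma^2\pm\sqrt{1-4c\sigma^2}}{2c}$ for one of the two signs. Then: (i) if $0\le R\le\min\{R_{r_0+1}(\Sigma_Y),R_{r_0+1}(\Sigma_{X|Y})\}$, then $D_{CE}(R)=D_{X|Y}(R)$;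 (ii) for such $R$, if $k_I\in[r]$ and $k_{CE}\in[L]$ satisfy $R_{k_I}(\Sigma_{X|Y})<R\le R_{k_I+1}(\Sigma_{X|Y})$ and $R_{k_{CE}}(\Sigma_Y)<R\le R_{k_{CE}+1}(\Sigma_Y)$, the closed-form expressions $$1-\frac1M\sum_{l=1}^{k_I}\frac{\lambda_l}{\lambda_l+\sigma^2}+\frac{k_I}{M}\theta_{k_I}(\Sigma_{X|Y},R)\quad\text{and}\quad 1-\frac1M\sum_{l=1}^{k_{CE}}\frac{\lambda_l}{\lambda_l+\sigma^2}+\frac{\theta_{k_{CE}}(\Sigma_Y,R)}{M}\sum_{l=1}^{k_{CE}}\frac{\lambda_l}{(\lambda_l+\sigma^2)^2}$$ are equal; (iii) if $r_0=L=M$, then $D_{CE}(R)=D_{X|Y}(R)$ for all $R\ge0$; (iv) $D_{CE}(R)\ge D_{X|Y}(R)$ for all $R\ge0$. -/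

import Mathlib

open MeasureTheory ProbabilityTheory Matrix
open scoped ENNReal

namespace RemoteSource

/-- Vectors in `ℝⁿ` with the Euclidean norm. -/
abbrev Vec (n : ℕ) : Type := EuclideanSpace ℝ (Fin n)

/-! ### Spectral quantities -/

/-- `eig C l` is the `l`-th largest eigenvalue (`1 ≤ l ≤ n`, counted with multiplicity) of the
real symmetric matrix `C`; the value is `0` outside this range. -/
noncomputable def eig {n : ℕ} (C : Matrix (Fin n) (Fin n) ℝ) (l : ℕ) : ℝ :=
  open Classical in
  if h : C.IsHermitian ∧ 1 ≤ l ∧ l ≤ n then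
    h.1.eigenvalues₀ ⟨l - 1, by rw [Fintype.card_fin]; omega⟩
  else 0

/-- The rate thresholds `R_k(C)` in bits, for `1 ≤ k ≤ rank C + 1`: `R_1(C) = 0`,
`R_k(C) = (1/2) ∑_{l ≤ k} log₂ (λ_l(C) / λ_k(C))` for `2 ≤ k ≤ rank C`, and
`R_{rank C + 1}(C) = ∞`. -/
noncomputable def rateThreshold {n : ℕ} (C : Matrix (Fin n) (Fin n) ℝ) (k : ℕ) : EReal :=
  if k = 1 then 0
  else if k ≤ C.rank then
    ((1 / 2 * ∑ l ∈ Finset.Icc 1 k, Real.logb 2 (eig C l / eig C k) : ℝ) : EReal)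
  else ⊤

/-- `θ_k(C, R) = 2^(-2R/k) (∏_{l ≤ k} λ_l(C))^(1/k)`. -/
noncomputable def thetaLevel {n : ℕ} (C : Matrix (Fin n) (Fin n) ℝ) (k : ℕ) (R : ℝ) : ℝ :=
  (2 : ℝ) ^ (-(2 * R) / (k : ℝ)) * (∏ l ∈ Finset.Icc 1 k, eig C l) ^ (1 / (k : ℝ))

/-- The covariance `Σ_Y = A Aᵀ + σ² I` of the observation. -/
noncomputable def covY {L M : ℕ} (A : Matrix (Fin L) (Fin M) ℝ) (σ : ℝ) :
    Matrix (Fin L) (Fin L) ℝ :=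
  A * Aᵀ + σ ^ 2 • (1 : Matrix (Fin L) (Fin L) ℝ)

lemma covY_isHermitian {L M : ℕ} (A : Matrix (Fin L) (Fin M) ℝ) (σ : ℝ) :
    (covY A σ).IsHermitian := by
  rw [Matrix.IsHermitian, Matrix.conjTranspose_eq_transpose_of_trivial]
  simp [covY, Matrix.transpose_mul]

/-- The matrix `Σ_{X|Y} = Aᵀ (A Aᵀ + σ² I)⁻¹ A`, the covariance of the estimate `E[X | Y]`. -/
noncomputable def covEst {L M : ℕ} (A : Matrix (Fin L) (Fin M) ℝ) (σ : ℝ) :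
    Matrix (Fin M) (Fin M) ℝ :=
  Aᵀ * (covY A σ)⁻¹ * A

/-- `spec A l = λ_l`, the `l`-th largest eigenvalue of `A Aᵀ`, `1 ≤ l ≤ L`. -/
noncomputable def spec {L M : ℕ} (A : Matrix (Fin L) (Fin M) ℝ) (l : ℕ) : ℝ :=
  eig (A * Aᵀ) l

/-- The closed form of the iDRF with `k` active components. -/
noncomputable def iDRFExpr {L M : ℕ} (A : Matrix (Fin L) (Fin M) ℝ) (σ : ℝ) (k : ℕ) (R : ℝ) : ℝ :=
  1 - 1 / (M : ℝ) * ∑ l ∈ Finset.Icc 1 k, spec A l / (spec A l + σ ^ 2)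
    + (k : ℝ) / (M : ℝ) * thetaLevel (covEst A σ) k R

/-- The closed form of the CE-DRF with `k` active components. -/
noncomputable def ceDRFExpr {L M : ℕ} (A : Matrix (Fin L) (Fin M) ℝ) (σ : ℝ) (k : ℕ) (R : ℝ) : ℝ :=
  1 - 1 / (M : ℝ) * ∑ l ∈ Finset.Icc 1 k, spec A l / (spec A l + σ ^ 2)
    + thetaLevel (covY A σ) k R / (M : ℝ)
      * ∑ l ∈ Finset.Icc 1 k, spec A l / (spec A l + σ ^ 2) ^ 2

/-! ### The Gaussian model -/

/-- The joint law of `(Y, X)` where `X ∼ N(0, I_M)` and `Y = A X + W` with `W ∼ N(0, σ² I_L)`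
independent of `X`. -/
noncomputable def modelLaw {L M : ℕ} (A : Matrix (Fin L) (Fin M) ℝ) (σ : ℝ) :
    Measure (Vec L × Vec M) :=
  ((stdGaussian (Vec M)).prod
      (multivariateGaussian (0 : Vec L) (σ ^ 2 • (1 : Matrix (Fin L) (Fin L) ℝ)))).map
    (fun p => (WithLp.toLp 2 (A *ᵥ p.1.ofLp) + p.2, p.1))

instance {L M : ℕ} (A : Matrix (Fin L) (Fin M) ℝ) (σ : ℝ) :
    IsProbabilityMeasure (modelLaw A σ) := by
  unfold modelLaw
  have h : Measurable (fun p : Vec M × Vec L =>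
      ((WithLp.toLp 2 (A *ᵥ p.1.ofLp) + p.2, p.1) : Vec L × Vec M)) := by
    have h1 : Continuous (fun p : Vec M × Vec L => A *ᵥ p.1.ofLp) := by fun_prop
    have h2 : Continuous (fun p : Vec M × Vec L =>
        ((WithLp.toLp 2 (A *ᵥ p.1.ofLp) + p.2, p.1) : Vec L × Vec M)) := by fun_prop
    exact h2.measurable
  exact Measure.isProbabilityMeasure_map h.aemeasurable

/-- The law of the observation `Y`. -/
noncomputable def obsLaw {L M : ℕ} (A : Matrix (Fin L) (Fin M) ℝ) (σ : ℝ) : Measure (Vec L) :=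
  (modelLaw A σ).fst

/-- A version of the conditional law of `X` given `Y = y`. -/
noncomputable def posterior {L M : ℕ} (A : Matrix (Fin L) (Fin M) ℝ) (σ : ℝ) :
    Kernel (Vec L) (Vec M) :=
  (modelLaw A σ).condKernel

/-- Mutual information, in bits, between the two coordinates of a random pair with law `ρ`. -/
noncomputable def mutualInfo {α β : Type*} [MeasurableSpace α] [MeasurableSpace β]
    (ρ : Measure (α × β)) : ℝ≥0∞ :=
  InformationTheory.klDiv ρ (ρ.fst.prod ρ.snd) / ENNReal.ofReal (Real.log 2)

/-- The normalized quadratic distortion `(1/M) E ‖X - X̂‖²` when `(Y, X̂)` has law `ρ` and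
`X`, `Y`, `X̂` form a Markov chain (in this order). -/
noncomputable def distortion {L M : ℕ} (A : Matrix (Fin L) (Fin M) ℝ) (σ : ℝ)
    (ρ : Measure (Vec L × Vec M)) : ℝ≥0∞ :=
  (M : ℝ≥0∞)⁻¹ *
    ∫⁻ p, ∫⁻ x, ENNReal.ofReal (‖x - p.2‖ ^ 2) ∂(posterior A σ p.1) ∂ρ

/-- The indirect distortion-rate function `D_{X|Y}(R)`: the infimum of the distortion over all
joint laws of `(Y, X̂)`, with the given law of `Y`, such that `I(Y; X̂) ≤ R`. -/
noncomputable def iDRF {L M : ℕ} (A : Matrix (Fin L) (Fin M) ℝ) (σ R : ℝ) : ℝ≥0∞ :=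
  ⨅ (ρ : Measure (Vec L × Vec M))
    (_ : ρ.fst = obsLaw A σ ∧ mutualInfo ρ ≤ ENNReal.ofReal R), distortion A σ ρ

/-! ### Compress-and-estimate -/

/-- The water level `θ` for compressing `Y` at rate `R`: it satisfies
`∑_l (1/2) log₂⁺ (λ_l(Σ_Y) / θ) = R`. It is unique for `R > 0`; for `R = 0` the least one,
`λ_1(Σ_Y)`, is taken. -/
noncomputable def waterLevel {L M : ℕ} (A : Matrix (Fin L) (Fin M) ℝ) (σ R : ℝ) : ℝ :=
  sInf {θ : ℝ | 0 < θ ∧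
    ∑ l ∈ Finset.Icc 1 L, 1 / 2 * Real.logb 2 (max 1 (eig (covY A σ) l / θ)) = R}

/-- The covariance `U diag(min(λ_l(Σ_Y), θ)) Uᵀ` of the noise of the backward channel, where `U` is
orthogonal and diagonalizes `Σ_Y`. -/
noncomputable def backwardNoiseCov {L M : ℕ} (A : Matrix (Fin L) (Fin M) ℝ) (σ R : ℝ) :
    Matrix (Fin L) (Fin L) ℝ :=
  let U : Matrix (Fin L) (Fin L) ℝ := (covY_isHermitian A σ).eigenvectorUnitary
  U * Matrix.diagonal
    (fun i => min ((covY_isHermitian A σ).eigenvalues i) (waterLevel A σ R)) * Uᵀ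

/-- The joint law of `(Y, Ŷ)` given by the backward Gaussian channel `Y = Ŷ + N`, where
`Ŷ ∼ N(0, Σ_Y - Σ_N)` and `N ∼ N(0, Σ_N)` are independent. -/
noncomputable def ceLaw {L M : ℕ} (A : Matrix (Fin L) (Fin M) ℝ) (σ R : ℝ) :
    Measure (Vec L × Vec L) :=
  ((multivariateGaussian (0 : Vec L) (covY A σ - backwardNoiseCov A σ R)).prod
      (multivariateGaussian (0 : Vec L) (backwardNoiseCov A σ R))).map
    (fun p => (p.1 + p.2, p.1))

/-- The compress-and-estimate distortion-rate function `D_CE(R)`: the infimum of the distortion of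
`g(Ŷ)` over all estimators `g`, that is, the normalized minimum mean square error of estimating `X`
from `Ŷ`. -/
noncomputable def ceDRF {L M : ℕ} (A : Matrix (Fin L) (Fin M) ℝ) (σ R : ℝ) : ℝ≥0∞ :=
  ⨅ (g : Vec L → Vec M) (_ : Measurable g),
    distortion A σ ((ceLaw A σ R).map (fun p => (p.1, g p.2)))

end RemoteSource

open RemoteSource

/-! Let `G = Aᵀ Σ_Y⁻¹` and `E = Σ_{X|Y}`. Given `Y`, the source is `G Y` plus an independent
Gaussian error of covariance `1 - E` (`modelLaw_eq_map`, `posterior_ae_eq`). The distortion of any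
law of `(Y, X̂)` is therefore `(1/M)(tr (1 - E) + E‖G Y - X̂‖²)` (`distortion_eq`), and the remote
problem becomes direct compression of the Gaussian vector `G Y`, whose covariance is `E`.

Two one-sided bounds suffice; the exact value of the iDRF is never needed. Lower bound
(`le_distortion`): rotating to the eigenbasis of `E` and applying Donsker–Varadhan with a Gaussian
log-likelihood ratio gives `E‖G Y - X̂‖² ≥ ∑ min(ν_l, t)` for every level `t` whose water-filling
rate is at least `R`, where `ν_l = λ_l / (λ_l + σ²)` are the eigenvalues of `E`. Upper bound
(`ceDRF_le`): the linear estimator `G Ŷ` has excess error `tr (G Σ_N Gᵀ) = ∑ λ_l / μ_l² · min(μ_l,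
θ)`, where `μ_l = λ_l + σ²` are the eigenvalues of `Σ_Y`.

On the first `r₀` components `λ_l / μ_l² = c`, that is, `ν_l = c μ_l`. The level `t = c θ` then
costs the same rate there, and `c · min(μ_l, θ) = min(ν_l, c θ)`. The bounds on `R` put all other
components under water in both problems, where each contributes `ν_l`. The two bounds coincide,
which proves equality (`ceDRF_eq_iDRF`). In the closed forms the same proportionality equates the
thresholds up to `r₀`, hence the active indices, and scales the levels by `c`
(`iDRFExpr_eq_ceDRFExpr`).

The inequality at all rates is data processing: every estimator `g` applied to the backward channel,
whose information is at most `R`, gives an admissible law (`iDRF_le_ceDRF`). -/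

namespace RemoteSource

/-! ### Ordered eigenvalues of symmetric matrices. -/

lemma eig_of_isHermitian {n : ℕ} {C : Matrix (Fin n) (Fin n) ℝ} (hC : C.IsHermitian) {l : ℕ}
    (h1 : 1 ≤ l) (hl : l ≤ n) :
    eig C l = hC.eigenvalues₀ ⟨l - 1, by rw [Fintype.card_fin]; omega⟩ := by
  rw [eig, dif_pos ⟨hC, h1, hl⟩]

lemma eig_of_lt {n : ℕ} (C : Matrix (Fin n) (Fin n) ℝ) {l : ℕ} (hl : n < l) : eig C l = 0 := by
  rw [eig, dif_neg]
  rintro ⟨-, -, h⟩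
  omega

/-- Sums over the ordered eigenvalues are sums over the eigenvalues. -/
lemma sum_eig {n : ℕ} {C : Matrix (Fin n) (Fin n) ℝ} (hC : C.IsHermitian) {E : Type*}
    [AddCommMonoid E] (g : ℝ → E) :
    ∑ l ∈ Finset.Icc 1 n, g (eig C l) = ∑ i, g (hC.eigenvalues i) := by
  have h1 : ∑ i, g (hC.eigenvalues i) = ∑ j, g (hC.eigenvalues₀ j) := by
    unfold Matrix.IsHermitian.eigenvalues
    exact Equiv.sum_comp ((Fintype.equivOfCardEq (Fintype.card_fin _)).symm :
      Fin n ≃ Fin (Fintype.card (Fin n))) (fun j => g (hC.eigenvalues₀ j))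
  have h2 : ∑ j, g (hC.eigenvalues₀ j) = ∑ j : Fin n, g (eig C (j + 1)) := by
    refine Fintype.sum_equiv (finCongr (Fintype.card_fin n)) _ _ fun j => ?_
    have hj : (j : ℕ) < n := by simpa using j.2
    rw [eig_of_isHermitian hC (by omega) (by simpa using hj)]
    rfl
  rw [h1, h2, Fin.sum_univ_eq_sum_range (fun j => g (eig C (j + 1))), Finset.sum_bij
    (fun l _ => l - 1)]
  · simp only [Finset.mem_Icc, Finset.mem_range]; intro l hl; omega
  · simp only [Finset.mem_Icc]; intro l hl k hk h; omega
  · intro j hj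
    simp only [Finset.mem_range] at hj
    exact ⟨j + 1, by simp; omega, by simp⟩
  · intro l hl
    simp only [Finset.mem_Icc] at hl
    rw [Nat.sub_add_cancel hl.1]

lemma eig_le_eig {n : ℕ} {C : Matrix (Fin n) (Fin n) ℝ} (hC : C.IsHermitian) {k l : ℕ}
    (h1 : 1 ≤ k) (hkl : k ≤ l) (hl : l ≤ n) : eig C l ≤ eig C k := by
  rw [eig_of_isHermitian hC h1 (hkl.trans hl), eig_of_isHermitian hC (h1.trans hkl) hl]
  exact hC.eigenvalues₀_antitone (by simp; omega)

/-- The ordered eigenvalues are determined by the roots of the characteristic polynomial. -/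
lemma eig_eq_of_roots {n : ℕ} {C : Matrix (Fin n) (Fin n) ℝ} (hC : C.IsHermitian) (d : ℕ → ℝ)
    (hd : ∀ k l, 1 ≤ k → k ≤ l → l ≤ n → d l ≤ d k)
    (hroots : C.charpoly.roots = Multiset.map (fun i : Fin n => d (i + 1)) Finset.univ.val)
    {l : ℕ} (h1 : 1 ≤ l) (hl : l ≤ n) : eig C l = d l := by
  have hs := hC.sort_roots_charpoly_eq_eigenvalues₀
  have hd' : (C.charpoly.roots.map RCLike.re).sort (· ≥ ·) =
      List.ofFn (fun i : Fin n => d (i + 1)) := by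
    simp_rw [hroots, Fin.univ_val_map, Multiset.map_coe, List.map_ofFn, Function.comp_def,
      Multiset.coe_sort]
    -- Sorting does nothing to a list that is already decreasing.
    apply List.mergeSort_of_pairwise
    simp_rw [decide_eq_true_eq, ← List.sortedGE_iff_pairwise]
    refine Antitone.sortedGE_ofFn fun i j hij => ?_
    exact hd _ _ (by omega) (by simpa using hij) (by omega)
  rw [eig_of_isHermitian hC h1 hl]
  have hlen : l - 1 < (List.ofFn hC.eigenvalues₀).length := by simp; omega
  have h3 : (List.ofFn hC.eigenvalues₀)[l - 1]'hlen = d l := by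
    have : List.ofFn hC.eigenvalues₀ = List.ofFn (fun i : Fin n => d (i + 1)) := hs.symm.trans hd'
    simp only [this, List.getElem_ofFn]
    rw [Nat.sub_add_cancel h1]
  simpa using h3

lemma charpoly_conj_diagonal {n : ℕ} {U : Matrix (Fin n) (Fin n) ℝ} (hU : Uᵀ * U = 1)
    (d : Fin n → ℝ) :
    (U * Matrix.diagonal d * Uᵀ).charpoly.roots = Multiset.map d Finset.univ.val := by
  rw [Matrix.charpoly_mul_comm, ← mul_assoc, hU, one_mul, Matrix.charpoly_diagonal,
    Polynomial.roots_prod]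
  · simp
  · simp [Finset.prod_ne_zero_iff, Polynomial.X_sub_C_ne_zero]

lemma exists_diagonalization {n : ℕ} {C : Matrix (Fin n) (Fin n) ℝ} (hC : C.IsHermitian) :
    ∃ U : Matrix (Fin n) (Fin n) ℝ, Uᵀ * U = 1 ∧ U * Uᵀ = 1 ∧
      C = U * Matrix.diagonal hC.eigenvalues * Uᵀ := by
  refine ⟨hC.eigenvectorUnitary, ?_, ?_, ?_⟩
  · have := Unitary.coe_star_mul_self hC.eigenvectorUnitary
    simpa [Matrix.star_eq_conjTranspose] using this
  · have := Unitary.coe_mul_star_self hC.eigenvectorUnitary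
    simpa [Matrix.star_eq_conjTranspose] using this
  · have := hC.spectral_theorem
    rw [Unitary.conjStarAlgAut_apply] at this
    simpa [Matrix.star_eq_conjTranspose] using this

/-- The two families are indexed differently, so only their multisets can be compared; this is
`sum_eig` in the additive monoid of multisets, applied to singletons. -/
lemma roots_map_eigenvalues {n : ℕ} {C : Matrix (Fin n) (Fin n) ℝ} (hC : C.IsHermitian)
    (g : ℝ → ℝ) :
    Multiset.map (fun i => g (hC.eigenvalues i)) Finset.univ.val
      = Multiset.map (fun i : Fin n => g (eig C (i + 1))) Finset.univ.val := by
  have h1 := sum_eig hC (fun x => ({g x} : Multiset ℝ))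
  have h2 : ∀ f : Fin n → ℝ, Multiset.map f Finset.univ.val = ∑ i, ({f i} : Multiset ℝ) := by
    intro f
    rw [← Multiset.sum_map_singleton (Multiset.map f Finset.univ.val), Multiset.map_map]
    rfl
  rw [h2, h2, ← h1, Fin.sum_univ_eq_sum_range (fun i => ({g (eig C (i + 1))} : Multiset ℝ)) n,
    Finset.range_eq_Ico, Finset.sum_Ico_add' (fun i => ({g (eig C i)} : Multiset ℝ)) 0 n 1]
  rfl

lemma rank_eq_card_eig {n : ℕ} {C : Matrix (Fin n) (Fin n) ℝ} (hC : C.IsHermitian) :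
    C.rank = ((Finset.Icc 1 n).filter (fun l => eig C l ≠ 0)).card := by
  classical
  rw [hC.rank_eq_card_non_zero_eigs, Fintype.card_subtype, Finset.card_filter, Finset.card_filter]
  exact (sum_eig hC (fun x => if x ≠ 0 then 1 else 0)).symm

/-! ### Spectra and ranks of `A Aᵀ`, `Σ_Y` and `Σ_{X|Y}`. -/

section Spectrum

variable {L M : ℕ} (A : Matrix (Fin L) (Fin M) ℝ) {σ : ℝ}

lemma posSemidef_self_mul_transpose : (A * Aᵀ).PosSemidef := by
  have := Matrix.posSemidef_self_mul_conjTranspose A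
  rwa [Matrix.conjTranspose_eq_transpose_of_trivial] at this

lemma spec_nonneg (l : ℕ) : 0 ≤ spec A l := by
  unfold spec eig
  split_ifs with h
  · have := (posSemidef_self_mul_transpose A).eigenvalues_nonneg
      ((Fintype.equivOfCardEq (Fintype.card_fin _)) ⟨l - 1, by rw [Fintype.card_fin]; omega⟩)
    simpa [Matrix.IsHermitian.eigenvalues] using this
  · exact le_rfl

lemma spec_anti {k l : ℕ} (h1 : 1 ≤ k) (hkl : k ≤ l) : spec A l ≤ spec A k := by
  by_cases hl : l ≤ L
  · exact eig_le_eig (posSemidef_self_mul_transpose A).1 h1 hkl hl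
  -- The default value `0` beyond `L` continues the decreasing sequence.
  · rw [spec, eig_of_lt _ (by omega)]
    exact spec_nonneg A k

/-- A downward closed predicate holds on an initial segment, whose length is its cardinality.
Applied to nonvanishing eigenvalues, it turns the rank into the last index with `λ_l > 0`. -/
lemma card_filter_le_of_antitone {p : ℕ → Prop} [DecidablePred p] {n : ℕ}
    (hp : ∀ k l, 1 ≤ k → k ≤ l → l ≤ n → p l → p k) {l : ℕ} (h1 : 1 ≤ l) (hl : l ≤ n) :
    p l ↔ l ≤ ((Finset.Icc 1 n).filter p).card := by
  constructor
  · intro h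
    calc l = (Finset.Icc 1 l).card := by simp
      _ ≤ _ := Finset.card_le_card fun k hk => by
        simp only [Finset.mem_Icc, Finset.mem_filter] at hk ⊢
        exact ⟨⟨hk.1, hk.2.trans hl⟩, hp k l hk.1 hk.2 hl h⟩
  · intro h
    by_contra hc
    have : ((Finset.Icc 1 n).filter p) ⊆ Finset.Icc 1 (l - 1) := fun k hk => by
      simp only [Finset.mem_Icc, Finset.mem_filter] at hk ⊢
      refine ⟨hk.1.1, ?_⟩
      by_contra hk'
      exact hc (hp l k h1 (by omega) hk.1.2 hk.2)
    have := Finset.card_le_card this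
    simp at this
    omega

lemma spec_pos_iff (hA : A.rank = min L M) {l : ℕ} (h1 : 1 ≤ l) :
    0 < spec A l ↔ l ≤ min L M := by
  by_cases hl : l ≤ L
  · have h := rank_eq_card_eig (posSemidef_self_mul_transpose A).1
    rw [Matrix.rank_self_mul_transpose, hA] at h
    have h2 := card_filter_le_of_antitone (p := fun l => eig (A * Aᵀ) l ≠ 0) (n := L)
      (fun k l hk hkl hl h => by
        have h3 := spec_anti A hk hkl
        have h4 := (spec_nonneg A l).lt_of_ne (Ne.symm h)
        exact (h4.trans_le h3).ne') h1 hl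
    rw [← h] at h2
    rw [← h2]
    exact (spec_nonneg A l).lt_iff_ne'
  · rw [spec, eig_of_lt _ (by omega)]
    simp only [lt_irrefl, false_iff]
    omega

lemma spec_eq_zero (hA : A.rank = min L M) {l : ℕ} (h1 : 1 ≤ l) (hl : min L M < l) :
    spec A l = 0 := by
  have := (spec_pos_iff A hA h1).not.2 (by omega)
  exact le_antisymm (not_lt.1 this) (spec_nonneg A l)

lemma covY_eq_conj {U : Matrix (Fin L) (Fin L) ℝ} (hU : U * Uᵀ = 1) {d : Fin L → ℝ}
    (hd : A * Aᵀ = U * Matrix.diagonal d * Uᵀ) :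
    covY A σ = U * Matrix.diagonal (fun i => d i + σ ^ 2) * Uᵀ := by
  have h : Matrix.diagonal (fun i => d i + σ ^ 2) = Matrix.diagonal d +
      σ ^ 2 • (1 : Matrix (Fin L) (Fin L) ℝ) := by
    ext i j
    by_cases hij : i = j <;> simp [Matrix.diagonal, hij]
  rw [covY, hd, h, mul_add, add_mul, Matrix.mul_smul, Matrix.mul_one, Matrix.smul_mul, hU]

lemma eig_covY {l : ℕ} (h1 : 1 ≤ l) (hl : l ≤ L) : eig (covY A σ) l = spec A l + σ ^ 2 := by
  obtain ⟨U, hU, hU', hd⟩ := exists_diagonalization (posSemidef_self_mul_transpose A).1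
  refine eig_eq_of_roots (covY_isHermitian A σ) (fun l => spec A l + σ ^ 2)
    (fun k l hk hkl _ => by have := spec_anti A hk hkl; linarith) ?_ h1 hl
  rw [covY_eq_conj A hU' hd, charpoly_conj_diagonal hU,
    roots_map_eigenvalues _ (fun x => x + σ ^ 2)]
  rfl

lemma eigenvalues_covY_ge (i : Fin L) : σ ^ 2 ≤ (covY_isHermitian A σ).eigenvalues i := by
  have h : ∃ l ∈ Finset.Icc 1 L, (covY_isHermitian A σ).eigenvalues i = eig (covY A σ) l := by
    set j := (Fintype.equivOfCardEq (Fintype.card_fin (Fintype.card (Fin L)))).symm i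
    have hj : (j : ℕ) < L := by simpa using j.2
    refine ⟨j + 1, by simp; omega, ?_⟩
    rw [eig_of_isHermitian (covY_isHermitian A σ) (by omega) (by omega)]
    rfl
  obtain ⟨l, hl, h⟩ := h
  rw [Finset.mem_Icc] at hl
  rw [h, eig_covY A hl.1 hl.2]
  linarith [spec_nonneg A l]

lemma covY_posDef (hσ : 0 < σ) : (covY A σ).PosDef := by
  rw [(covY_isHermitian A σ).posDef_iff_eigenvalues_pos]
  intro i
  have := eigenvalues_covY_ge A (σ := σ) i
  have : 0 < σ ^ 2 := by positivity
  linarith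

lemma covY_transpose : (covY A σ)ᵀ = covY A σ := by
  have := covY_isHermitian A σ
  rwa [Matrix.IsHermitian, Matrix.conjTranspose_eq_transpose_of_trivial] at this

lemma covEst_isHermitian : (covEst A σ).IsHermitian := by
  rw [Matrix.IsHermitian, Matrix.conjTranspose_eq_transpose_of_trivial, covEst]
  simp [Matrix.transpose_mul, Matrix.transpose_nonsing_inv, covY_transpose, Matrix.mul_assoc]

lemma ratio_le_ratio (hσ : 0 < σ) {x y : ℝ} (hx : 0 ≤ x) (hxy : x ≤ y) :
    x / (x + σ ^ 2) ≤ y / (y + σ ^ 2) := by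
  have : 0 < σ ^ 2 := by positivity
  rw [div_le_div_iff₀ (by linarith) (by linarith)]
  nlinarith

/-- `Aᵀ (Σ_Y⁻¹ A)` and `(Σ_Y⁻¹ A) Aᵀ` have the same characteristic roots up to zeros, and the second
matrix is diagonal in the eigenbasis of `A Aᵀ`. For `L < l ≤ M` the formula holds because `spec`
defaults to `0`. -/
lemma eig_covEst (hA : A.rank = min L M) (hσ : 0 < σ) {l : ℕ} (h1 : 1 ≤ l) (hl : l ≤ M) :
    eig (covEst A σ) l = spec A l / (spec A l + σ ^ 2) := by
  have hσ2 : 0 < σ ^ 2 := by positivity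
  obtain ⟨U, hU, hU', hd⟩ := exists_diagonalization (posSemidef_self_mul_transpose A).1
  set d := (posSemidef_self_mul_transpose A).1.eigenvalues with hdd
  have hdnn : ∀ i, 0 ≤ d i := (posSemidef_self_mul_transpose A).eigenvalues_nonneg
  set D : ℕ → ℝ := fun l => spec A l / (spec A l + σ ^ 2) with hD
  refine eig_eq_of_roots (covEst_isHermitian A) D
    (fun k l hk hkl _ => ratio_le_ratio hσ (spec_nonneg A l) (spec_anti A hk hkl)) ?_ h1 hl
  have hinv : (covY A σ)⁻¹ = U * Matrix.diagonal (fun i => (d i + σ ^ 2)⁻¹) * Uᵀ := by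
    refine Matrix.inv_eq_right_inv ?_
    rw [covY_eq_conj A hU' hd]
    calc U * diagonal (fun i => d i + σ ^ 2) * Uᵀ * (U * diagonal (fun i => (d i + σ ^ 2)⁻¹) * Uᵀ)
        = U * (diagonal (fun i => d i + σ ^ 2) * (Uᵀ * U) *
            diagonal (fun i => (d i + σ ^ 2)⁻¹)) * Uᵀ := by simp only [Matrix.mul_assoc]
      _ = 1 := by
        rw [hU, Matrix.mul_one, Matrix.diagonal_mul_diagonal]
        have : (fun i => (d i + σ ^ 2) * (d i + σ ^ 2)⁻¹) = fun _ => 1 := by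
          funext i
          exact mul_inv_cancel₀ (by linarith [hdnn i])
        rw [this, Matrix.diagonal_one, Matrix.mul_one, hU']
  have hprod : ((covY A σ)⁻¹ * A) * Aᵀ =
      U * Matrix.diagonal (fun i => d i / (d i + σ ^ 2)) * Uᵀ := by
    rw [Matrix.mul_assoc, hd, hinv]
    calc U * diagonal (fun i => (d i + σ ^ 2)⁻¹) * Uᵀ * (U * diagonal d * Uᵀ)
        = U * (diagonal (fun i => (d i + σ ^ 2)⁻¹) * (Uᵀ * U) * diagonal d) * Uᵀ := by
          simp only [Matrix.mul_assoc]
      _ = _ := by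
        rw [hU, Matrix.mul_one, Matrix.diagonal_mul_diagonal]
        simp only [div_eq_inv_mul]
  have hcomm := Matrix.charpoly_mul_comm' Aᵀ ((covY A σ)⁻¹ * A)
  rw [← Matrix.mul_assoc] at hcomm
  have hroots := congrArg Polynomial.roots hcomm
  have hm1 : (covEst A σ).charpoly ≠ 0 := (Matrix.charpoly_monic _).ne_zero
  have hm2 : ((covY A σ)⁻¹ * A * Aᵀ).charpoly ≠ 0 := (Matrix.charpoly_monic _).ne_zero
  rw [← covEst, Polynomial.roots_mul (mul_ne_zero (pow_ne_zero _ Polynomial.X_ne_zero) hm1),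
    Polynomial.roots_mul (mul_ne_zero (pow_ne_zero _ Polynomial.X_ne_zero) hm2), hprod,
    charpoly_conj_diagonal hU, roots_map_eigenvalues _ (fun x => x / (x + σ ^ 2)),
    Polynomial.roots_X_pow, Polynomial.roots_X_pow, Fintype.card_fin, Fintype.card_fin] at hroots
  have hrange : ∀ n : ℕ, Multiset.map (fun i : Fin n => D (i + 1)) Finset.univ.val
      = ∑ i ∈ Finset.range n, ({D (i + 1)} : Multiset ℝ) := fun n => by
    rw [← Fin.sum_univ_eq_sum_range (fun i => ({D (i + 1)} : Multiset ℝ)),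
      ← Multiset.sum_map_singleton (Multiset.map _ Finset.univ.val), Multiset.map_map]
    rfl
  -- Beyond `min L M` all values vanish, so padding by zeros only lengthens the list. Both sides of
  -- `hroots` are compared with the list of the first `L + M` values.
  have hext : ∀ n k : ℕ, min L M ≤ n →
      k • ({0} : Multiset ℝ) + ∑ i ∈ Finset.range n, ({D (i + 1)} : Multiset ℝ)
        = ∑ i ∈ Finset.range (n + k), ({D (i + 1)} : Multiset ℝ) := fun n k hn => by
    rw [Finset.sum_range_add, add_comm]
    congr 1
    rw [Finset.sum_congr rfl (g := fun _ => ({0} : Multiset ℝ))]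
    · simp
    · intro i _
      rw [hD]
      simp only [spec_eq_zero A hA (l := n + i + 1) (by omega) (by omega), zero_div]
  refine add_left_cancel (hroots.trans ?_)
  have e1 := hext L M (by omega)
  have e2 := hext M L (by omega)
  rw [← hrange] at e1 e2
  rw [add_comm M L] at e2
  exact e1.trans e2.symm

lemma rank_covY (hσ : 0 < σ) : (covY A σ).rank = L := by
  have := Matrix.rank_of_isUnit _ (covY_posDef A hσ).isUnit
  simpa using this

lemma rank_covEst (hA : A.rank = min L M) (hσ : 0 < σ) : (covEst A σ).rank = min L M := by
  have hσ2 : 0 < σ ^ 2 := by positivity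
  rw [rank_eq_card_eig (covEst_isHermitian A)]
  have : (Finset.Icc 1 M).filter (fun l => eig (covEst A σ) l ≠ 0) = Finset.Icc 1 (min L M) := by
    ext l
    simp only [Finset.mem_filter, Finset.mem_Icc]
    constructor
    · rintro ⟨⟨h1, h2⟩, h⟩
      refine ⟨h1, ?_⟩
      by_contra hc
      rw [eig_covEst A hA hσ h1 h2, spec_eq_zero A hA h1 (by omega)] at h
      simp at h
    · rintro ⟨h1, h2⟩
      refine ⟨⟨h1, by omega⟩, ?_⟩
      rw [eig_covEst A hA hσ h1 (by omega)]
      have := (spec_pos_iff A hA h1).2 h2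
      positivity
  rw [this]
  simp

end Spectrum

/-! ### Variational bound and exact value of the Kullback–Leibler divergence; product densities. -/

section Divergence

variable {α : Type*} [MeasurableSpace α]

/-- The lower half of the Donsker–Varadhan variational formula. -/
lemma integral_le_toReal_klDiv {ρ π : Measure α} [IsProbabilityMeasure ρ] [IsProbabilityMeasure π]
    {f : α → ℝ} (hf : Measurable f) (hint : Integrable f ρ)
    (hexp : ∫⁻ x, ENNReal.ofReal (Real.exp (f x)) ∂π ≤ 1)
    (hkl : InformationTheory.klDiv ρ π ≠ ∞) :
    ∫ x, f x ∂ρ ≤ (InformationTheory.klDiv ρ π).toReal := by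
  obtain ⟨hac, hllr⟩ := InformationTheory.klDiv_ne_top_iff.1 hkl
  -- Tilting `π` by `exp f` gives a measure of mass at most one; the claim is nonnegativity of the
  -- divergence of `ρ` from it, since `llr ρ ν = llr ρ π - f`.
  set ν := π.withDensity (fun x => ENNReal.ofReal (Real.exp (f x))) with hν
  have hmeas : Measurable (fun x => ENNReal.ofReal (Real.exp (f x))) := by fun_prop
  have hνuniv : ν Set.univ ≤ 1 := by
    rw [hν, withDensity_apply _ MeasurableSet.univ, Measure.restrict_univ]
    exact hexp
  have : IsFiniteMeasure ν := ⟨hνuniv.trans_lt ENNReal.one_lt_top⟩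
  have hac' : ρ ≪ ν := hac.trans
    (withDensity_absolutelyContinuous' hmeas.aemeasurable (ae_of_all _ fun x => by positivity))
  have hrn := Measure.rnDeriv_withDensity_right ρ π hmeas.aemeasurable
    (ae_of_all _ fun x => (by positivity : ENNReal.ofReal (Real.exp (f x)) ≠ 0))
    (ae_of_all _ fun x => ENNReal.ofReal_ne_top)
  have hl : llr ρ ν =ᵐ[ρ] fun x => llr ρ π x - f x := by
    filter_upwards [hac.ae_le hrn, Measure.rnDeriv_pos hac, hac.ae_le (Measure.rnDeriv_lt_top ρ π)]
      with x hx hpos hlt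
    replace hpos := ENNReal.toReal_pos hpos.ne' hlt.ne
    rw [llr, llr, hx, ENNReal.toReal_mul, ENNReal.toReal_inv,
      ENNReal.toReal_ofReal (Real.exp_pos _).le, Real.log_mul (by positivity) hpos.ne',
      Real.log_inv, Real.log_exp]
    ring
  have hint' : Integrable (llr ρ ν) ρ := (integrable_congr hl).2 (hllr.sub hint)
  have h0 := InformationTheory.integral_llr_add_sub_measure_univ_nonneg hac' hint'
  rw [integral_congr_ae hl, integral_sub hllr hint] at h0
  rw [InformationTheory.toReal_klDiv_of_measure_eq hac (by simp)]
  have h1 : ν.real Set.univ ≤ 1 := ENNReal.toReal_le_of_le_ofReal zero_le_one (by simpa using hνuniv)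
  have h2 : ρ.real Set.univ = 1 := by simp
  linarith

/-- The log-likelihood ratio is `f` itself, and the mass corrections cancel because both measures
are probabilities. -/
lemma klDiv_withDensity_exp {π : Measure α} [IsProbabilityMeasure π] {f : α → ℝ}
    (hf : Measurable f)
    [IsProbabilityMeasure (π.withDensity (fun x => ENNReal.ofReal (Real.exp (f x))))]
    (hint : Integrable f (π.withDensity (fun x => ENNReal.ofReal (Real.exp (f x))))) :
    InformationTheory.klDiv (π.withDensity (fun x => ENNReal.ofReal (Real.exp (f x)))) π =
      ENNReal.ofReal (∫ x, f x ∂(π.withDensity (fun x => ENNReal.ofReal (Real.exp (f x))))) := by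
  have hac := withDensity_absolutelyContinuous π (fun x => ENNReal.ofReal (Real.exp (f x)))
  set ρ := π.withDensity (fun x => ENNReal.ofReal (Real.exp (f x))) with hρ
  have hmeas : Measurable (fun x => ENNReal.ofReal (Real.exp (f x))) := by fun_prop
  have hl : llr ρ π =ᵐ[ρ] f := by
    filter_upwards [hac.ae_le (Measure.rnDeriv_withDensity π hmeas)] with x hx
    rw [llr, hx, ENNReal.toReal_ofReal (Real.exp_pos _).le, Real.log_exp]
  rw [InformationTheory.klDiv_of_ac_of_integrable hac ((integrable_congr hl).2 hint),
    integral_congr_ae hl]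
  simp

lemma lintegral_pi_prod {ι : Type*} [Fintype ι] {Ω : ι → Type*} [∀ i, MeasurableSpace (Ω i)]
    (μ : ∀ i, Measure (Ω i)) [∀ i, IsProbabilityMeasure (μ i)] {f : ∀ i, Ω i → ℝ≥0∞}
    (hf : ∀ i, Measurable (f i)) :
    ∫⁻ x, ∏ i, f i (x i) ∂(Measure.pi μ) = ∏ i, ∫⁻ x, f i x ∂(μ i) := by
  refine (lintegral_prod_eq_prod_lintegral_of_indepFun Finset.univ
    (fun i (x : ∀ i, Ω i) => f i (x i)) (iIndepFun_pi fun i => (hf i).aemeasurable)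
    (fun i => (hf i).comp (measurable_pi_apply i))).trans ?_
  refine Finset.prod_congr rfl fun i _ => ?_
  exact (measurePreserving_eval μ i).lintegral_comp (hf i)

lemma pi_withDensity_prod {ι : Type*} [Fintype ι] {Ω : ι → Type*} [∀ i, MeasurableSpace (Ω i)]
    (μ : ∀ i, Measure (Ω i)) [∀ i, IsProbabilityMeasure (μ i)] {f : ∀ i, Ω i → ℝ≥0∞}
    (hf : ∀ i, Measurable (f i)) [∀ i, SigmaFinite ((μ i).withDensity (f i))] :
    (Measure.pi μ).withDensity (fun x => ∏ i, f i (x i)) =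
      Measure.pi (fun i => (μ i).withDensity (f i)) := by
  symm
  refine Measure.pi_eq fun s hs => ?_
  rw [withDensity_apply _ (MeasurableSet.univ_pi hs), ← lintegral_indicator (MeasurableSet.univ_pi hs)]
  have : (Set.univ.pi s).indicator (fun x : ∀ i, Ω i => ∏ i, f i (x i)) =
      fun x => ∏ i, (s i).indicator (f i) (x i) := by
    classical
    ext x
    by_cases h : x ∈ Set.univ.pi s
    · rw [Set.indicator_of_mem h]
      exact Finset.prod_congr rfl fun i _ => (Set.indicator_of_mem (h i trivial) _).symm
    · rw [Set.indicator_of_notMem h]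
      simp only [Set.mem_pi, Set.mem_univ, true_implies, not_forall] at h
      obtain ⟨i, hi⟩ := h
      exact (Finset.prod_eq_zero (Finset.mem_univ i) (Set.indicator_of_notMem hi _)).symm
  rw [this, lintegral_pi_prod μ fun i => (hf i).indicator (hs i)]
  refine Finset.prod_congr rfl fun i _ => ?_
  rw [withDensity_apply _ (hs i), lintegral_indicator (hs i)]

end Divergence

/-! ### Scalar Gaussian likelihood ratios. -/

section Tilt

/-- The logarithm of the density of `N(x, b)` with respect to `N(0, m)`. -/
noncomputable def gaussianLogRatio (m b : NNReal) (z x : ℝ) : ℝ :=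
  1 / 2 * Real.log (m / b) + z ^ 2 / (2 * m) - (z - x) ^ 2 / (2 * b)

lemma measurable_gaussianLogRatio {α : Type*} [MeasurableSpace α] (m b : NNReal) {f g : α → ℝ}
    (hf : Measurable f) (hg : Measurable g) :
    Measurable (fun p => gaussianLogRatio m b (f p) (g p)) := by
  unfold gaussianLogRatio
  fun_prop

lemma withDensity_gaussianLogRatio {m b : NNReal} (hm : m ≠ 0) (hb : b ≠ 0) (x : ℝ) :
    (gaussianReal 0 m).withDensity
      (fun z => ENNReal.ofReal (Real.exp (gaussianLogRatio m b z x))) = gaussianReal x b := by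
  have hm' : (0 : ℝ) < m := by positivity
  have hb' : (0 : ℝ) < b := by positivity
  have hmeas : Measurable (fun z => ENNReal.ofReal (Real.exp (gaussianLogRatio m b z x))) := by
    have := measurable_gaussianLogRatio m b measurable_id (measurable_const (a := x))
    exact (Real.measurable_exp.comp this).ennreal_ofReal
  rw [gaussianReal_of_var_ne_zero _ hm, gaussianReal_of_var_ne_zero _ hb,
    ← withDensity_mul _ (measurable_gaussianPDF 0 m) hmeas]
  congr 1
  ext z
  simp only [Pi.mul_apply, gaussianPDF]
  rw [← ENNReal.ofReal_mul (gaussianPDFReal_nonneg _ _ _)]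
  congr 1
  simp only [gaussianPDFReal, gaussianLogRatio]
  have hlog : Real.exp (1 / 2 * Real.log (m / b)) = √m / √b := by
    rw [← Real.sqrt_div hm'.le, Real.sqrt_eq_rpow, Real.rpow_def_of_pos (by positivity)]
    ring_nf
  have h2 : ∀ t : ℝ, √(2 * Real.pi * t) = √(2 * Real.pi) * √t := fun t =>
    Real.sqrt_mul (by positivity) t
  rw [sub_zero, sub_eq_add_neg (_ + _), Real.exp_add, Real.exp_add, hlog, h2, h2]
  have e1 : Real.exp (-z ^ 2 / (2 * m)) * Real.exp (z ^ 2 / (2 * m)) = 1 := by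
    rw [← Real.exp_add, neg_div, neg_add_cancel, Real.exp_zero]
  have hsm : √(m : ℝ) ≠ 0 := by positivity
  have hsb : √(b : ℝ) ≠ 0 := by positivity
  have hsp : √(2 * Real.pi) ≠ 0 := by positivity
  calc _ = (√(2 * Real.pi) * √m)⁻¹ * (√m / √b) *
        (Real.exp (-z ^ 2 / (2 * m)) * Real.exp (z ^ 2 / (2 * m))) *
          Real.exp (-((z - x) ^ 2 / (2 * b))) := by ring
    _ = _ := by
      rw [e1, neg_div]
      field_simp

/-- This makes the ratio admissible in Donsker–Varadhan for every `v`, including `v = 0`. If `t ≤ v`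
it is a genuine density, of integral one. If `v ≤ t` the logarithmic and `z²` terms cancel, and the
moment generating function gives `exp (-x² (t - v) / (2 t²)) ≤ 1`. -/
lemma lintegral_exp_gaussianLogRatio_le (v : NNReal) {t : NNReal} (ht : t ≠ 0) (x : ℝ) :
    ∫⁻ z, ENNReal.ofReal (Real.exp (gaussianLogRatio (max v t) t z x)) ∂(gaussianReal 0 v) ≤ 1 := by
  have ht' : (0 : ℝ) < t := by positivity
  rcases le_total t v with h | h
  · rw [max_eq_left h]
    have hv : v ≠ 0 := fun hv => ht (le_antisymm (hv ▸ h) zero_le)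
    have := congrArg (fun μ : Measure ℝ => μ Set.univ) (withDensity_gaussianLogRatio hv ht x)
    simp only [withDensity_apply _ MeasurableSet.univ, Measure.restrict_univ, measure_univ] at this
    exact this.le
  · rw [max_eq_right h]
    have e : ∀ z, Real.exp (gaussianLogRatio t t z x) =
        Real.exp (-x ^ 2 / (2 * t)) * Real.exp (x / t * z) := fun z => by
      rw [← Real.exp_add, gaussianLogRatio, div_self ht'.ne', Real.log_one]
      congr 1
      field_simp
      ring
    simp_rw [e]
    have hint : Integrable (fun z => Real.exp (-x ^ 2 / (2 * t)) * Real.exp (x / t * z))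
        (gaussianReal 0 v) := (integrable_exp_mul_gaussianReal _).const_mul _
    rw [← ofReal_integral_eq_lintegral_ofReal hint (ae_of_all _ fun z => by positivity),
      integral_const_mul]
    have hmgf := congrFun (mgf_id_gaussianReal (μ := 0) (v := v)) (x / t)
    simp only [mgf, id] at hmgf
    rw [hmgf, ← Real.exp_add, ENNReal.ofReal_le_one, Real.exp_le_one_iff]
    have hvt : (v : ℝ) ≤ t := h
    have : -x ^ 2 / (2 * t) + (0 * (x / t) + v * (x / t) ^ 2 / 2)
        = - (x ^ 2 * (t - v) / (2 * t ^ 2)) := by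
      field_simp
      ring
    rw [this]
    have : 0 ≤ x ^ 2 * (t - v) / (2 * (t : ℝ) ^ 2) := by
      have : (0 : ℝ) ≤ t - v := by linarith
      positivity
    linarith

lemma integral_sq_gaussianReal (v : NNReal) : ∫ x, x ^ 2 ∂(gaussianReal 0 v) = v := by
  have h := variance_id_gaussianReal (μ := 0) (v := v)
  rw [variance_eq_integral (by fun_prop)] at h
  simpa using h

lemma integrable_sq_gaussianReal (v : NNReal) :
    Integrable (fun x : ℝ => x ^ 2) (gaussianReal 0 v) := by
  have := memLp_id_gaussianReal (μ := 0) (v := v) 2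
  exact this.integrable_sq

end Tilt

/-! ### Converse and achievability for parallel Gaussian components. -/

section ParallelGaussian

variable {ι : Type*} [Fintype ι]

lemma exp_sum_gaussianLogRatio (m b : ι → NNReal) (z x : ι → ℝ) :
    ENNReal.ofReal (Real.exp (∑ i, gaussianLogRatio (m i) (b i) (z i) (x i))) =
      ∏ i, ENNReal.ofReal (Real.exp (gaussianLogRatio (m i) (b i) (z i) (x i))) := by
  rw [Real.exp_sum, ENNReal.ofReal_prod_of_nonneg fun i _ => (Real.exp_pos _).le]

lemma measurable_sum_gaussianLogRatio (m b : ι → NNReal) :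
    Measurable (fun p : (ι → ℝ) × (ι → ℝ) =>
      ∑ i, gaussianLogRatio (m i) (b i) (p.1 i) (p.2 i)) :=
  Finset.measurable_sum _ fun i _ => measurable_gaussianLogRatio _ _
    ((measurable_pi_apply i).comp measurable_fst) ((measurable_pi_apply i).comp measurable_snd)

lemma measurable_exp_gaussianLogRatio (m b : NNReal) (x : ℝ) :
    Measurable (fun z => ENNReal.ofReal (Real.exp (gaussianLogRatio m b z x))) :=
  (Real.measurable_exp.comp
    (measurable_gaussianLogRatio m b measurable_id measurable_const)).ennreal_ofReal

lemma measurePreserving_coord_of_fst_eq {ρ : Measure ((ι → ℝ) × (ι → ℝ))}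
    {v : ι → NNReal} (hfst : ρ.fst = Measure.pi fun i => gaussianReal 0 (v i)) (i : ι) :
    MeasurePreserving (fun p : (ι → ℝ) × (ι → ℝ) => p.1 i) ρ (gaussianReal 0 (v i)) :=
  (measurePreserving_eval _ i).comp ⟨measurable_fst, hfst⟩

/-- The converse for parallel Gaussian components: at rate
`∑ (1/2) log max(1, v_i/t)` nats the mean square error is at least `∑ min(v_i, t)`. -/
lemma sum_min_le_lintegral_of_klDiv_le {v : ι → NNReal} {t : NNReal} (ht : t ≠ 0)
    {ρ : Measure ((ι → ℝ) × (ι → ℝ))} [IsProbabilityMeasure ρ]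
    (hfst : ρ.fst = Measure.pi fun i => gaussianReal 0 (v i))
    (hkl : InformationTheory.klDiv ρ (ρ.fst.prod ρ.snd) ≤
      ENNReal.ofReal (∑ i, 1 / 2 * Real.log (max 1 (v i / t)))) :
    ENNReal.ofReal (∑ i, min (v i : ℝ) t) ≤
      ∫⁻ p, ENNReal.ofReal (∑ i, (p.1 i - p.2 i) ^ 2) ∂ρ := by
  have ht' : (0 : ℝ) < t := by positivity
  have hDmeas : Measurable (fun p : (ι → ℝ) × (ι → ℝ) => ∑ i, (p.1 i - p.2 i) ^ 2) := by fun_prop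
  -- Infinite distortion is trivial; finite distortion supplies the integrability needed below.
  by_cases htop : ∫⁻ p, ENNReal.ofReal (∑ i, (p.1 i - p.2 i) ^ 2) ∂ρ = ∞
  · rw [htop]; exact le_top
  have hDnn : ∀ p : (ι → ℝ) × (ι → ℝ), 0 ≤ ∑ i, (p.1 i - p.2 i) ^ 2 := fun p => by positivity
  have hDint : Integrable (fun p : (ι → ℝ) × (ι → ℝ) => ∑ i, (p.1 i - p.2 i) ^ 2) ρ := by
    rw [← lintegral_ofReal_ne_top_iff_integrable hDmeas.aestronglyMeasurable (ae_of_all _ hDnn)]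
    exact htop
  set m : ι → NNReal := fun i => max (v i) t with hm
  have hsq : ∀ i, Integrable (fun p : (ι → ℝ) × (ι → ℝ) => p.1 i ^ 2) ρ := fun i =>
    (measurePreserving_coord_of_fst_eq hfst i).integrable_comp_of_integrable
      (integrable_sq_gaussianReal (v i))
  have hsqv : ∀ i, ∫ p, p.1 i ^ 2 ∂ρ = v i := fun i => by
    rw [← integral_sq_gaussianReal (v i), ← (measurePreserving_coord_of_fst_eq hfst i).map_eq,
      integral_map (by fun_prop) (by fun_prop)]
  -- The test function involves only the squares of the source coordinates and the total squared
  -- error, so its mean depends on `ρ` only through the given variances and the distortion.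
  have hdecomp : ∀ p : (ι → ℝ) × (ι → ℝ),
      ∑ i, gaussianLogRatio (m i) t (p.1 i) (p.2 i) =
        (∑ i, (1 / 2 * Real.log (m i / t) + (2 * (m i : ℝ))⁻¹ * p.1 i ^ 2))
          - (2 * (t : ℝ))⁻¹ * ∑ i, (p.1 i - p.2 i) ^ 2 := fun p => by
    rw [Finset.mul_sum, ← Finset.sum_sub_distrib]
    refine Finset.sum_congr rfl fun i _ => ?_
    rw [gaussianLogRatio]
    ring
  have hint1 : ∀ i, Integrable (fun p : (ι → ℝ) × (ι → ℝ) =>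
      1 / 2 * Real.log (m i / t) + (2 * (m i : ℝ))⁻¹ * p.1 i ^ 2) ρ := fun i =>
    (integrable_const _).add ((hsq i).const_mul _)
  have hint : Integrable (fun p : (ι → ℝ) × (ι → ℝ) =>
      ∑ i, gaussianLogRatio (m i) t (p.1 i) (p.2 i)) ρ := by
    simp_rw [hdecomp]
    exact (integrable_finsetSum _ fun i _ => hint1 i).sub (hDint.const_mul _)
  have hexp : ∫⁻ p, ENNReal.ofReal
      (Real.exp (∑ i, gaussianLogRatio (m i) t (p.1 i) (p.2 i))) ∂(ρ.fst.prod ρ.snd) ≤ 1 := by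
    have hmeas : Measurable (fun p : (ι → ℝ) × (ι → ℝ) => ENNReal.ofReal
        (Real.exp (∑ i, gaussianLogRatio (m i) t (p.1 i) (p.2 i)))) := (Real.measurable_exp.comp
      (measurable_sum_gaussianLogRatio m (fun _ : ι => t))).ennreal_ofReal
    -- For a fixed reconstruction the integral over the source factors into scalar integrals, each
    -- at most one.
    rw [lintegral_prod_symm _ hmeas.aemeasurable]
    calc _ ≤ ∫⁻ _, 1 ∂ρ.snd := by
          refine lintegral_mono fun x => ?_
          simp_rw [exp_sum_gaussianLogRatio m (fun _ => t)]
          rw [hfst, lintegral_pi_prod _ fun i => measurable_exp_gaussianLogRatio (m i) t (x i)]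
          exact Finset.prod_le_one' fun i _ => lintegral_exp_gaussianLogRatio_le (v i) ht (x i)
      _ = 1 := by simp
  have hne : InformationTheory.klDiv ρ (ρ.fst.prod ρ.snd) ≠ ∞ :=
    ne_top_of_le_ne_top ENNReal.ofReal_ne_top hkl
  have hDV := integral_le_toReal_klDiv
    (measurable_sum_gaussianLogRatio m (fun _ : ι => t)) hint hexp hne
  have hklr := ENNReal.toReal_le_of_le_ofReal (Finset.sum_nonneg fun i _ =>
    mul_nonneg (by norm_num) (Real.log_nonneg (le_max_left _ _))) hkl
  have hI : ∫ p, ∑ i, gaussianLogRatio (m i) t (p.1 i) (p.2 i) ∂ρ =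
      (∑ i, (1 / 2 * Real.log (m i / t) + (2 * (m i : ℝ))⁻¹ * v i))
        - (2 * (t : ℝ))⁻¹ * ∫ p, ∑ i, (p.1 i - p.2 i) ^ 2 ∂ρ := by
    simp_rw [hdecomp]
    rw [integral_sub (integrable_finsetSum _ fun i _ => hint1 i) (hDint.const_mul _),
      integral_finsetSum _ fun i _ => hint1 i, integral_const_mul]
    congr 1
    refine Finset.sum_congr rfl fun i _ => ?_
    rw [integral_add (integrable_const _) ((hsq i).const_mul _), integral_const, probReal_univ,
      one_smul, integral_const_mul, hsqv]
  have hlog : ∀ i, Real.log (max 1 ((v i : ℝ) / t)) = Real.log (m i / t) := fun i => by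
    congr 1
    rw [hm, NNReal.coe_max, ← max_div_div_right ht'.le, div_self ht'.ne', max_comm]
  -- With `m = max(v, t)` one has `v / m = min(v, t) / t`; the logarithmic terms then cancel against
  -- the rate bound and leave the distortion inequality.
  have hmin : ∀ i, (2 * (m i : ℝ))⁻¹ * v i = (2 * (t : ℝ))⁻¹ * min (v i : ℝ) t := fun i => by
    rw [hm]
    rcases le_total (v i) t with h | h
    · have h' : (v i : ℝ) ≤ t := h
      simp only [max_eq_right h, min_eq_left h']
    · have h' : (t : ℝ) ≤ v i := h
      have : (0 : ℝ) < v i := ht'.trans_le h'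
      simp only [max_eq_left h, min_eq_right h']
      field_simp
  rw [hI, Finset.sum_add_distrib] at hDV
  simp_rw [hlog] at hklr
  simp_rw [hmin, ← Finset.mul_sum] at hDV
  rw [← ofReal_integral_eq_lintegral_ofReal hDint (ae_of_all _ hDnn)]
  refine ENNReal.ofReal_le_ofReal ?_
  rw [← Finset.mul_sum] at hklr
  have : (2 * (t : ℝ))⁻¹ * (∑ i, min (v i : ℝ) t) ≤
      (2 * (t : ℝ))⁻¹ * ∫ p, ∑ i, (p.1 i - p.2 i) ^ 2 ∂ρ := by linarith
  exact le_of_mul_le_mul_left this (by positivity)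

/-- The information carried by a parallel additive Gaussian channel with Gaussian input. -/
lemma klDiv_add_pi_gaussianReal_le (a b : ι → NNReal) (hb : ∀ i, b i ≠ 0) :
    InformationTheory.klDiv
      (((Measure.pi fun i => gaussianReal 0 (a i)).prod (Measure.pi fun i => gaussianReal 0 (b i))).map
        (fun p : (ι → ℝ) × (ι → ℝ) => (p.1 + p.2, p.1)))
      ((Measure.pi fun i => gaussianReal 0 (a i + b i)).prod (Measure.pi fun i => gaussianReal 0 (a i)))
    ≤ ENNReal.ofReal (∑ i, 1 / 2 * Real.log ((a i + b i : ℝ) / b i)) := by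
  set Pa := Measure.pi fun i => gaussianReal 0 (a i) with hPa
  set Pb := Measure.pi fun i => gaussianReal 0 (b i) with hPb
  set Pm := Measure.pi fun i => gaussianReal 0 (a i + b i) with hPm
  set f : (ι → ℝ) × (ι → ℝ) → ℝ := fun p =>
    ∑ i, gaussianLogRatio (a i + b i) (b i) (p.1 i) (p.2 i) with hf
  have hfm : Measurable f := measurable_sum_gaussianLogRatio (fun i => a i + b i) b
  have hfe : Measurable (fun p => ENNReal.ofReal (Real.exp (f p))) :=
    (Real.measurable_exp.comp hfm).ennreal_ofReal
  have hm : ∀ i, a i + b i ≠ 0 := fun i h => hb i (by simpa using (add_eq_zero.1 h).2)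
  have hadd : Measurable (fun p : (ι → ℝ) × (ι → ℝ) => (p.1 + p.2, p.1)) := by fun_prop
  -- The conditional law of the output given input `x` is the noise law shifted by `x`, written as a
  -- density with respect to the output marginal.
  have hshift : ∀ x : ι → ℝ, Pb.map (fun n => x + n) =
      Pm.withDensity (fun y => ENNReal.ofReal (Real.exp (f (y, x)))) := fun x => by
    have h1 : Pb.map (fun n => x + n) = Measure.pi fun i => gaussianReal (x i) (b i) := by
      have := Measure.pi_map_pi (μ := fun i => gaussianReal 0 (b i)) (f := fun i n => x i + n)
        (fun i => by fun_prop)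
      simp_rw [gaussianReal_map_const_add, zero_add] at this
      rw [← this]
      rfl
    have hs : ∀ i, (gaussianReal 0 (a i + b i)).withDensity (fun z => ENNReal.ofReal
        (Real.exp (gaussianLogRatio (a i + b i) (b i) z (x i)))) = gaussianReal (x i) (b i) :=
      fun i => withDensity_gaussianLogRatio (hm i) (hb i) (x i)
    have : ∀ i, SigmaFinite ((gaussianReal 0 (a i + b i)).withDensity (fun z => ENNReal.ofReal
        (Real.exp (gaussianLogRatio (a i + b i) (b i) z (x i))))) := fun i => by
      rw [hs i]; infer_instance
    rw [h1, hf]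
    simp_rw [exp_sum_gaussianLogRatio (fun i => a i + b i) b]
    rw [hPm, pi_withDensity_prod _ fun i => measurable_exp_gaussianLogRatio (a i + b i) (b i) (x i)]
    simp_rw [hs]
  have hρ : (Pa.prod Pb).map (fun p : (ι → ℝ) × (ι → ℝ) => (p.1 + p.2, p.1)) =
      (Pm.prod Pa).withDensity (fun p => ENNReal.ofReal (Real.exp (f p))) := by
    refine Measure.ext_of_lintegral _ fun F hF => ?_
    have hFadd : Measurable (fun p : (ι → ℝ) × (ι → ℝ) => F (p.1 + p.2, p.1)) := hF.comp hadd
    rw [lintegral_map hF hadd, lintegral_prod _ hFadd.aemeasurable,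
      lintegral_withDensity_eq_lintegral_mul _ hfe hF,
      lintegral_prod_symm _ (hfe.mul hF).aemeasurable]
    refine lintegral_congr fun x => ?_
    have hFx : Measurable (fun y => F (y, x)) := hF.comp (by fun_prop)
    rw [← lintegral_map (g := fun n => x + n) hFx (by fun_prop), hshift,
      lintegral_withDensity_eq_lintegral_mul _
        (f := fun y => ENNReal.ofReal (Real.exp (f (y, x)))) (hfe.comp (by fun_prop)) hFx]
    rfl
  have hprob : IsProbabilityMeasure
      ((Pa.prod Pb).map (fun p : (ι → ℝ) × (ι → ℝ) => (p.1 + p.2, p.1))) :=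
    Measure.isProbabilityMeasure_map hadd.aemeasurable
  have hx1 : ∀ i, MeasurePreserving (fun p : (ι → ℝ) × (ι → ℝ) => p.1 i + p.2 i) (Pa.prod Pb)
      (gaussianReal 0 (a i + b i)) := fun i => by
    have h1 := (measurePreserving_eval (fun i => gaussianReal 0 (a i)) i).prod
      (measurePreserving_eval (fun i => gaussianReal 0 (b i)) i)
    have h2 : MeasurePreserving (fun q : ℝ × ℝ => q.1 + q.2)
        ((gaussianReal 0 (a i)).prod (gaussianReal 0 (b i))) (gaussianReal 0 (a i + b i)) := by
      refine ⟨by fun_prop, ?_⟩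
      have := gaussianReal_conv_gaussianReal (m₁ := 0) (m₂ := 0) (v₁ := a i) (v₂ := b i)
      rw [Measure.conv, add_zero] at this
      exact this
    exact h2.comp h1
  have hx2 : ∀ i, MeasurePreserving (fun p : (ι → ℝ) × (ι → ℝ) => p.2 i) (Pa.prod Pb)
      (gaussianReal 0 (b i)) := fun i =>
    (measurePreserving_eval _ i).comp measurePreserving_snd
  have hi1 : ∀ i, Integrable (fun p : (ι → ℝ) × (ι → ℝ) => (p.1 i + p.2 i) ^ 2) (Pa.prod Pb) :=
    fun i => (hx1 i).integrable_comp_of_integrable (integrable_sq_gaussianReal _)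
  have hi2 : ∀ i, Integrable (fun p : (ι → ℝ) × (ι → ℝ) => p.2 i ^ 2) (Pa.prod Pb) :=
    fun i => (hx2 i).integrable_comp_of_integrable (integrable_sq_gaussianReal _)
  have he1 : ∀ i, ∫ p, (p.1 i + p.2 i) ^ 2 ∂(Pa.prod Pb) = (a i + b i : NNReal) := fun i => by
    rw [← integral_sq_gaussianReal (a i + b i), ← (hx1 i).map_eq,
      integral_map (by fun_prop) (by fun_prop)]
  have he2 : ∀ i, ∫ p, p.2 i ^ 2 ∂(Pa.prod Pb) = b i := fun i => by
    rw [← integral_sq_gaussianReal (b i), ← (hx2 i).map_eq,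
      integral_map (by fun_prop) (by fun_prop)]
  have hcomp : ∀ p : (ι → ℝ) × (ι → ℝ), f (p.1 + p.2, p.1) =
      ∑ i, (1 / 2 * Real.log (((a i + b i : NNReal) : ℝ) / b i) +
        ((2 * ((a i + b i : NNReal) : ℝ))⁻¹ * (p.1 i + p.2 i) ^ 2
          - (2 * (b i : ℝ))⁻¹ * p.2 i ^ 2)) := fun p => by
    rw [hf]
    refine Finset.sum_congr rfl fun i _ => ?_
    simp only [gaussianLogRatio, Pi.add_apply]
    ring
  have hterm : ∀ i, Integrable (fun p : (ι → ℝ) × (ι → ℝ) =>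
      1 / 2 * Real.log (((a i + b i : NNReal) : ℝ) / b i) +
        ((2 * ((a i + b i : NNReal) : ℝ))⁻¹ * (p.1 i + p.2 i) ^ 2
          - (2 * (b i : ℝ))⁻¹ * p.2 i ^ 2)) (Pa.prod Pb) := fun i =>
    (integrable_const _).add (((hi1 i).const_mul _).sub ((hi2 i).const_mul _))
  have hint : Integrable f
      ((Pa.prod Pb).map (fun p : (ι → ℝ) × (ι → ℝ) => (p.1 + p.2, p.1))) := by
    rw [integrable_map_measure hfm.aestronglyMeasurable hadd.aemeasurable, Function.comp_def]
    simp_rw [hcomp]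
    exact integrable_finsetSum _ fun i _ => hterm i
  have hval : ∫ p, f p ∂((Pa.prod Pb).map (fun p : (ι → ℝ) × (ι → ℝ) => (p.1 + p.2, p.1))) =
      ∑ i, 1 / 2 * Real.log ((a i + b i : ℝ) / b i) := by
    rw [integral_map hadd.aemeasurable hfm.aestronglyMeasurable]
    simp_rw [hcomp]
    rw [integral_finsetSum _ fun i _ => hterm i]
    refine Finset.sum_congr rfl fun i _ => ?_
    have hsub : Integrable (fun p : (ι → ℝ) × (ι → ℝ) =>
        (2 * ((a i + b i : NNReal) : ℝ))⁻¹ * (p.1 i + p.2 i) ^ 2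
          - (2 * (b i : ℝ))⁻¹ * p.2 i ^ 2) (Pa.prod Pb) :=
      ((hi1 i).const_mul _).sub ((hi2 i).const_mul _)
    rw [integral_add (integrable_const _) hsub, integral_const, probReal_univ, one_smul,
      integral_sub ((hi1 i).const_mul _) ((hi2 i).const_mul _), integral_const_mul,
      integral_const_mul, he1, he2]
    have h1 : ((a i + b i : NNReal) : ℝ) ≠ 0 := by exact_mod_cast hm i
    have h2 : (b i : ℝ) ≠ 0 := by exact_mod_cast hb i
    -- The normalized squares of output and noise have equal means, so only the logarithms survive.
    have h3 : (2 * ((a i + b i : NNReal) : ℝ))⁻¹ * ((a i + b i : NNReal) : ℝ)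
        - (2 * (b i : ℝ))⁻¹ * b i = 0 := by
      field_simp
      norm_num
    rw [h3]
    simp
  rw [hρ] at hprob hint hval ⊢
  rw [klDiv_withDensity_exp hfm hint, hval]

end ParallelGaussian

/-! ### Linear images, sums and second moments of Gaussian vectors. -/

section VectorGaussian

variable {m n : ℕ}

lemma inner_toLp_mulVec (T : Matrix (Fin m) (Fin n) ℝ) (x : Vec n) (t : Vec m) :
    inner ℝ (WithLp.toLp 2 (T *ᵥ x.ofLp) : Vec m) t =
      inner ℝ x (WithLp.toLp 2 (Tᵀ *ᵥ t.ofLp) : Vec n) := by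
  simp only [EuclideanSpace.inner_eq_star_dotProduct, star_trivial]
  rw [Matrix.dotProduct_mulVec, Matrix.mulVec_transpose]

lemma continuous_toLp_mulVec (T : Matrix (Fin m) (Fin n) ℝ) :
    Continuous (fun x : Vec n => (WithLp.toLp 2 (T *ᵥ x.ofLp) : Vec m)) := by
  have : Continuous (fun x : Vec n => T *ᵥ x.ofLp) := by fun_prop
  fun_prop

lemma measurable_toLp_mulVec (T : Matrix (Fin m) (Fin n) ℝ) :
    Measurable (fun x : Vec n => (WithLp.toLp 2 (T *ᵥ x.ofLp) : Vec m)) :=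
  (continuous_toLp_mulVec T).measurable

/-- The image of a centered Gaussian under a matrix. -/
lemma multivariateGaussian_map_mulVec {C : Matrix (Fin n) (Fin n) ℝ} (hC : C.PosSemidef)
    (T : Matrix (Fin m) (Fin n) ℝ) :
    (multivariateGaussian (0 : Vec n) C).map (fun x => (WithLp.toLp 2 (T *ᵥ x.ofLp) : Vec m)) =
      multivariateGaussian 0 (T * C * Tᵀ) := by
  have hTC : (T * C * Tᵀ).PosSemidef := by
    have := hC.mul_mul_conjTranspose_same T
    rwa [Matrix.conjTranspose_eq_transpose_of_trivial] at this
  have : IsProbabilityMeasure ((multivariateGaussian (0 : Vec n) C).map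
      (fun x => (WithLp.toLp 2 (T *ᵥ x.ofLp) : Vec m))) :=
    Measure.isProbabilityMeasure_map (measurable_toLp_mulVec T).aemeasurable
  refine Measure.ext_of_charFun ?_
  ext t
  rw [charFun_apply, integral_map (measurable_toLp_mulVec T).aemeasurable (by fun_prop)]
  simp_rw [inner_toLp_mulVec]
  rw [← charFun_apply, charFun_multivariateGaussian hC, charFun_multivariateGaussian hTC]
  simp only [inner_zero_right, Complex.ofReal_zero, zero_mul, zero_sub]
  congr 4
  rw [← Matrix.mulVec_mulVec, ← Matrix.mulVec_mulVec, Matrix.dotProduct_mulVec t.ofLp,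
    ← Matrix.mulVec_transpose]

lemma multivariateGaussian_conv {C D : Matrix (Fin n) (Fin n) ℝ} (hC : C.PosSemidef)
    (hD : D.PosSemidef) :
    ((multivariateGaussian (0 : Vec n) C).prod (multivariateGaussian (0 : Vec n) D)).map
      (fun p => p.1 + p.2) = multivariateGaussian 0 (C + D) := by
  change (multivariateGaussian (0 : Vec n) C).conv (multivariateGaussian (0 : Vec n) D) = _
  refine Measure.ext_of_charFun ?_
  ext t
  rw [charFun_conv, charFun_multivariateGaussian hC, charFun_multivariateGaussian hD,
    charFun_multivariateGaussian (hC.add hD), ← Complex.exp_add]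
  simp only [Matrix.add_mulVec, dotProduct_add, inner_zero_right, Complex.ofReal_zero, zero_mul,
    zero_sub, Complex.ofReal_add]
  congr 1
  ring

lemma pi_gaussianReal_map_toLp (d : Fin n → NNReal) :
    (Measure.pi fun i => gaussianReal 0 (d i)).map (WithLp.toLp 2) =
      multivariateGaussian (0 : Vec n) (Matrix.diagonal fun i => (d i : ℝ)) := by
  have hd : (Matrix.diagonal fun i => (d i : ℝ)).PosSemidef :=
    Matrix.PosSemidef.diagonal fun i => (d i).2
  have : IsProbabilityMeasure ((Measure.pi fun i => gaussianReal 0 (d i)).map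
      (WithLp.toLp 2 : (Fin n → ℝ) → Vec n)) :=
    Measure.isProbabilityMeasure_map (by fun_prop)
  refine Measure.ext_of_charFun (E := Vec n) ?_
  ext t
  rw [charFun_pi, charFun_multivariateGaussian hd]
  simp_rw [charFun_gaussianReal]
  rw [← Complex.exp_sum]
  congr 1
  simp only [Matrix.mulVec_diagonal, dotProduct, inner_zero_right, Complex.ofReal_zero, zero_mul,
    mul_zero, zero_sub, Complex.ofReal_sum, Finset.sum_div, Finset.sum_neg_distrib]
  congr 1
  refine Finset.sum_congr rfl fun i _ => ?_
  push_cast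
  ring

lemma pi_gaussianReal_map_mulVec (d : Fin n → NNReal) (V : Matrix (Fin m) (Fin n) ℝ) :
    (Measure.pi fun i => gaussianReal 0 (d i)).map (fun x => (WithLp.toLp 2 (V *ᵥ x) : Vec m)) =
      multivariateGaussian 0 (V * (Matrix.diagonal fun i => (d i : ℝ)) * Vᵀ) := by
  have hd : (Matrix.diagonal fun i => (d i : ℝ)).PosSemidef :=
    Matrix.PosSemidef.diagonal fun i => (d i).2
  rw [← multivariateGaussian_map_mulVec hd, ← pi_gaussianReal_map_toLp,
    Measure.map_map (measurable_toLp_mulVec V) (by fun_prop)]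
  rfl

/-- The squared norm is a sum over coordinates, so only the scalar marginals matter; the cross terms
vanish because the mean is zero. -/
lemma lintegral_norm_add_sq {C : Matrix (Fin n) (Fin n) ℝ} (hC : C.PosSemidef) (b : Vec n) :
    ∫⁻ s, ENNReal.ofReal (‖b + s‖ ^ 2) ∂(multivariateGaussian (0 : Vec n) C) =
      ENNReal.ofReal (‖b‖ ^ 2 + C.trace) := by
  have hcoord : ∀ i, MeasurePreserving (fun s : Vec n => s i) (multivariateGaussian (0 : Vec n) C)
      (gaussianReal 0 (C i i).toNNReal) := fun i => by
    simpa using measurePreserving_eval_multivariateGaussian (μ := (0 : Vec n)) hC (i := i)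
  have hid : ∀ i, Integrable (fun s : ℝ => 2 * b i * s) (gaussianReal 0 (C i i).toNNReal) :=
    fun i => ((memLp_id_gaussianReal 1).integrable le_rfl).const_mul _
  have hsq : ∀ i, Integrable (fun s : ℝ => b i ^ 2 + 2 * b i * s + s ^ 2)
      (gaussianReal 0 (C i i).toNNReal) := fun i =>
    ((integrable_const _).add (hid i)).add (integrable_sq_gaussianReal _)
  have hval : ∀ i, ∫ s, b i ^ 2 + 2 * b i * s + s ^ 2 ∂(gaussianReal 0 (C i i).toNNReal) =
      b i ^ 2 + C i i := fun i => by
    have h1 : Integrable (fun s : ℝ => b i ^ 2 + 2 * b i * s) (gaussianReal 0 (C i i).toNNReal) :=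
      (integrable_const _).add (hid i)
    rw [integral_add h1 (integrable_sq_gaussianReal _),
      integral_add (integrable_const _) (hid i), integral_const_mul, integral_id_gaussianReal,
      integral_sq_gaussianReal, Real.coe_toNNReal _ hC.diag_nonneg]
    simp
  have hnorm : ∀ s : Vec n, ‖b + s‖ ^ 2 = ∑ i, (b i ^ 2 + 2 * b i * s i + s i ^ 2) := fun s => by
    rw [EuclideanSpace.real_norm_sq_eq]
    refine Finset.sum_congr rfl fun i _ => ?_
    rw [PiLp.add_apply]
    ring
  have hint : ∀ i, Integrable (fun s : Vec n => b i ^ 2 + 2 * b i * s i + s i ^ 2)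
      (multivariateGaussian (0 : Vec n) C) := fun i =>
    (hcoord i).integrable_comp_of_integrable (hsq i)
  have hint' : Integrable (fun s : Vec n => ‖b + s‖ ^ 2) (multivariateGaussian (0 : Vec n) C) := by
    simp_rw [hnorm]
    exact integrable_finsetSum _ fun i _ => hint i
  rw [← ofReal_integral_eq_lintegral_ofReal hint' (ae_of_all _ fun s => by positivity)]
  congr 1
  simp_rw [hnorm]
  rw [integral_finsetSum _ fun i _ => hint i, EuclideanSpace.real_norm_sq_eq, Matrix.trace,
    ← Finset.sum_add_distrib]
  refine Finset.sum_congr rfl fun i _ => ?_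
  rw [Matrix.diag_apply, ← hval i, ← (hcoord i).map_eq,
    integral_map (by fun_prop) (by fun_prop)]

/-- `Vec m × Vec n` carries no inner product, so joint laws are compared through dual functionals;
on a product measure these factor into ordinary characteristic functions. -/
lemma charFunDual_map_prod {E : Type*} [NormedAddCommGroup E] [NormedSpace ℝ E]
    [MeasurableSpace E] [BorelSpace E] [SecondCountableTopology E]
    (P : Measure (Vec m)) (Q : Measure (Vec n)) [SFinite P] [SFinite Q]
    {f : Vec m × Vec n → E} (hf : Measurable f) (ℓ : StrongDual ℝ E) (s : Vec m) (t : Vec n)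
    (h : ∀ p, ℓ (f p) = inner ℝ p.1 s + inner ℝ p.2 t) :
    charFunDual ((P.prod Q).map f) ℓ = charFun P s * charFun Q t := by
  rw [charFunDual_apply, integral_map hf.aemeasurable (by fun_prop)]
  simp_rw [h, Complex.ofReal_add, add_mul, Complex.exp_add]
  rw [charFun_apply, charFun_apply, ← integral_prod_mul]

end VectorGaussian

/-- Data processing for maps acting separately on the coordinates, which keep the reference measure
a product. -/
lemma klDiv_map_prodMap_le {α β α' β' : Type*} [MeasurableSpace α] [MeasurableSpace β]
    [MeasurableSpace α'] [MeasurableSpace β'] (ρ : Measure (α × β)) (P : Measure α) (Q : Measure β)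
    [IsProbabilityMeasure ρ] [IsProbabilityMeasure P] [IsProbabilityMeasure Q]
    {f : α → α'} {g : β → β'} (hf : Measurable f) (hg : Measurable g) :
    InformationTheory.klDiv (ρ.map (Prod.map f g)) ((P.map f).prod (Q.map g)) ≤
      InformationTheory.klDiv ρ (P.prod Q) := by
  rw [Measure.map_prod_map _ _ hf hg]
  exact InformationTheory.klDiv_map_le _ _ (hf.prodMap hg)

/-! ### Conditional law of the source given the observation, and splitting of the distortion. -/

section Model

variable {L M : ℕ} (A : Matrix (Fin L) (Fin M) ℝ) {σ : ℝ}

/-- The matrix `Aᵀ Σ_Y⁻¹` of the linear estimator of `X` from `Y`. -/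
noncomputable def gain (A : Matrix (Fin L) (Fin M) ℝ) (σ : ℝ) : Matrix (Fin M) (Fin L) ℝ :=
  Aᵀ * (covY A σ)⁻¹

/-- The conditional covariance of `X` given `Y`. -/
noncomputable def errCov (A : Matrix (Fin L) (Fin M) ℝ) (σ : ℝ) : Matrix (Fin M) (Fin M) ℝ :=
  1 - covEst A σ

lemma gain_mul_covY (hσ : 0 < σ) : gain A σ * covY A σ = Aᵀ := by
  have := (Matrix.isUnit_iff_isUnit_det _).1 (covY_posDef A hσ).isUnit
  rw [gain, Matrix.mul_assoc, Matrix.nonsing_inv_mul _ this, Matrix.mul_one]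

lemma gain_mul : gain A σ * A = covEst A σ := rfl

lemma transpose_mul_gain_transpose : Aᵀ * (gain A σ)ᵀ = covEst A σ := by
  have := covEst_isHermitian A (σ := σ)
  rw [Matrix.IsHermitian, Matrix.conjTranspose_eq_transpose_of_trivial] at this
  rw [← Matrix.transpose_mul, gain_mul, this]

lemma gain_mul_covY_mul_transpose (hσ : 0 < σ) :
    gain A σ * covY A σ * (gain A σ)ᵀ = covEst A σ := by
  rw [gain_mul_covY A hσ, transpose_mul_gain_transpose]

lemma covEst_posSemidef (hσ : 0 < σ) : (covEst A σ).PosSemidef := by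
  have := (covY_posDef A hσ).posSemidef.mul_mul_conjTranspose_same (gain A σ)
  rwa [Matrix.conjTranspose_eq_transpose_of_trivial, gain_mul_covY_mul_transpose A hσ] at this

/-- `X - G Y = (1 - G A) X - G W`, so its covariance is `(1 - E)(1 - E)ᵀ + σ² G Gᵀ`. Since `G Σ_Y Gᵀ
= E` and `G A = E`, the last term is `E - E²` and the sum is `1 - E`. -/
lemma errCov_posSemidef (hσ : 0 < σ) : (errCov A σ).PosSemidef := by
  set G := gain A σ with hG
  set E := covEst A σ with hE
  have h1 : G * (σ ^ 2 • (1 : Matrix (Fin L) (Fin L) ℝ)) * Gᵀ = E - E * E := by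
    have h2 : covY A σ = A * Aᵀ + σ ^ 2 • (1 : Matrix (Fin L) (Fin L) ℝ) := rfl
    have h3 : G * (A * Aᵀ) * Gᵀ = E * E := by
      rw [← Matrix.mul_assoc, Matrix.mul_assoc _ Aᵀ, transpose_mul_gain_transpose, gain_mul]
    have h4 := gain_mul_covY_mul_transpose A hσ
    rw [h2, Matrix.mul_add, Matrix.add_mul, ← hG, h3] at h4
    rw [eq_sub_iff_add_eq, add_comm, h4]
  have h : errCov A σ = (1 - E) * (1 - E)ᴴ
      + G * (σ ^ 2 • (1 : Matrix (Fin L) (Fin L) ℝ)) * Gᴴ := by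
    have hEt : Eᴴ = E := covEst_isHermitian A
    rw [Matrix.conjTranspose_sub, hEt, Matrix.conjTranspose_one,
      Matrix.conjTranspose_eq_transpose_of_trivial, h1, errCov]
    noncomm_ring
  rw [h]
  refine (Matrix.posSemidef_self_mul_conjTranspose _).add
    (Matrix.PosSemidef.mul_mul_conjTranspose_same ?_ G)
  exact Matrix.PosSemidef.one.smul (by positivity)

lemma noise_posSemidef : (σ ^ 2 • (1 : Matrix (Fin L) (Fin L) ℝ)).PosSemidef :=
  Matrix.PosSemidef.one.smul (by positivity)

/-- The observation and the error of the linear estimator are independent Gaussians. -/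
lemma modelLaw_eq_map (hσ : 0 < σ) :
    modelLaw A σ =
      ((multivariateGaussian (0 : Vec L) (covY A σ)).prod
        (multivariateGaussian (0 : Vec M) (errCov A σ))).map
      (fun p => (p.1, WithLp.toLp 2 (gain A σ *ᵥ p.1.ofLp) + p.2)) := by
  have hf : Measurable (fun p : Vec M × Vec L =>
      ((WithLp.toLp 2 (A *ᵥ p.1.ofLp) + p.2, p.1) : Vec L × Vec M)) :=
    (((measurable_toLp_mulVec A).comp measurable_fst).add measurable_snd).prodMk measurable_fst
  have hg : Measurable (fun p : Vec L × Vec M =>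
      ((p.1, WithLp.toLp 2 (gain A σ *ᵥ p.1.ofLp) + p.2) : Vec L × Vec M)) :=
    measurable_fst.prodMk
      (((measurable_toLp_mulVec (gain A σ)).comp measurable_fst).add measurable_snd)
  have : IsProbabilityMeasure (((multivariateGaussian (0 : Vec L) (covY A σ)).prod
        (multivariateGaussian (0 : Vec M) (errCov A σ))).map
      (fun p => ((p.1, WithLp.toLp 2 (gain A σ *ᵥ p.1.ofLp) + p.2) : Vec L × Vec M))) :=
    Measure.isProbabilityMeasure_map hg.aemeasurable
  refine Measure.ext_of_charFunDual ?_
  ext ℓ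
  -- Riesz representation on each factor.
  obtain ⟨u, hu⟩ : ∃ u : Vec L, ∀ y : Vec L, ℓ (y, 0) = inner ℝ y u := by
    refine ⟨(InnerProductSpace.toDual ℝ (Vec L)).symm (ℓ.comp (.inl ℝ (Vec L) (Vec M))),
      fun y => ?_⟩
    rw [real_inner_comm, InnerProductSpace.toDual_symm_apply]
    simp
  obtain ⟨v, hv⟩ : ∃ v : Vec M, ∀ x : Vec M, ℓ (0, x) = inner ℝ x v := by
    refine ⟨(InnerProductSpace.toDual ℝ (Vec M)).symm (ℓ.comp (.inr ℝ (Vec L) (Vec M))),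
      fun y => ?_⟩
    rw [real_inner_comm, InnerProductSpace.toDual_symm_apply]
    simp
  have hℓ : ∀ y x, ℓ (y, x) = inner ℝ y u + inner ℝ x v := fun y x => by
    rw [← hu, ← hv, ← map_add, Prod.mk_add_mk, add_zero, zero_add]
  rw [modelLaw, charFunDual_map_prod _ _ hf ℓ (WithLp.toLp 2 (Aᵀ *ᵥ u.ofLp) + v) u,
    charFunDual_map_prod _ _ hg ℓ (u + WithLp.toLp 2 ((gain A σ)ᵀ *ᵥ v.ofLp)) v]
  · rw [← multivariateGaussian_zero_one, charFun_multivariateGaussian Matrix.PosSemidef.one,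
      charFun_multivariateGaussian noise_posSemidef,
      charFun_multivariateGaussian (covY_posDef A hσ).posSemidef,
      charFun_multivariateGaussian (errCov_posSemidef A hσ), ← Complex.exp_add, ← Complex.exp_add]
    congr 1
    simp only [inner_zero_right, Complex.ofReal_zero, zero_mul, zero_sub]
    rw [← neg_add, ← neg_add, ← add_div, ← add_div]
    congr 2
    rw [← Complex.ofReal_add, ← Complex.ofReal_add]
    congr 1
    set G := gain A σ with hG
    simp only [WithLp.ofLp_add]
    generalize u.ofLp = a
    generalize v.ofLp = b
    -- The quadratic forms in the exponents agree by `G Σ_Y = Aᵀ`, `G Σ_Y Gᵀ = E` and `Σ_Y = A Aᵀ +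
    -- σ² 1`.
    have e1 : (Gᵀ *ᵥ b) ⬝ᵥ (covY A σ *ᵥ a) = b ⬝ᵥ (Aᵀ *ᵥ a) := by
      rw [← gain_mul_covY A hσ, ← Matrix.mulVec_mulVec, Matrix.dotProduct_mulVec b,
        ← Matrix.mulVec_transpose]
    have e2 : a ⬝ᵥ (covY A σ *ᵥ (Gᵀ *ᵥ b)) = b ⬝ᵥ (Aᵀ *ᵥ a) := by
      rw [← e1, Matrix.dotProduct_mulVec a, ← Matrix.mulVec_transpose, covY_transpose,
        dotProduct_comm]
    have e3 : (Gᵀ *ᵥ b) ⬝ᵥ (covY A σ *ᵥ (Gᵀ *ᵥ b)) = b ⬝ᵥ (covEst A σ *ᵥ b) := by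
      rw [← gain_mul_covY_mul_transpose A hσ, ← hG, ← Matrix.mulVec_mulVec,
        ← Matrix.mulVec_mulVec, Matrix.dotProduct_mulVec b, ← Matrix.mulVec_transpose]
    have e4 : a ⬝ᵥ (covY A σ *ᵥ a) = (Aᵀ *ᵥ a) ⬝ᵥ (Aᵀ *ᵥ a)
        + a ⬝ᵥ ((σ ^ 2 • (1 : Matrix (Fin L) (Fin L) ℝ)) *ᵥ a) := by
      rw [covY, Matrix.add_mulVec, dotProduct_add, ← Matrix.mulVec_mulVec,
        Matrix.dotProduct_mulVec a, ← Matrix.mulVec_transpose]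
    simp only [Matrix.mulVec_add, dotProduct_add, add_dotProduct, e1, e2, e3, e4, errCov,
      Matrix.sub_mulVec, dotProduct_sub, Matrix.one_mulVec, dotProduct_comm (Aᵀ *ᵥ a) b]
    ring
  · intro p
    simp only [hℓ, inner_add_left, inner_add_right, inner_toLp_mulVec]
    ring
  · intro p
    simp only [hℓ, inner_add_left, inner_add_right, inner_toLp_mulVec]
    ring

lemma obsLaw_eq (hσ : 0 < σ) : obsLaw A σ = multivariateGaussian 0 (covY A σ) := by
  have hg : Measurable (fun p : Vec L × Vec M =>
      (WithLp.toLp 2 (gain A σ *ᵥ p.1.ofLp) + p.2 : Vec M)) :=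
    ((measurable_toLp_mulVec (gain A σ)).comp measurable_fst).add measurable_snd
  rw [obsLaw, modelLaw_eq_map A hσ, Measure.fst, Measure.map_map measurable_fst
    (measurable_fst.prodMk hg)]
  exact Measure.fst_prod

instance : IsProbabilityMeasure (obsLaw A σ) := by
  unfold obsLaw
  infer_instance

/-- The conditional law of `X` given `Y`. -/
lemma posterior_ae_eq (hσ : 0 < σ) : ∀ᵐ y ∂(obsLaw A σ), posterior A σ y =
    (multivariateGaussian (0 : Vec M) (errCov A σ)).map
      (fun e => WithLp.toLp 2 (gain A σ *ᵥ y.ofLp) + e) := by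
  have hg : Measurable (fun p : Vec L × Vec M =>
      (WithLp.toLp 2 (gain A σ *ᵥ p.1.ofLp) + p.2 : Vec M)) :=
    ((measurable_toLp_mulVec (gain A σ)).comp measurable_fst).add measurable_snd
  set Q := multivariateGaussian (0 : Vec M) (errCov A σ)
  set κ : Kernel (Vec L) (Vec M) := ((Kernel.id : Kernel (Vec L) (Vec L)) ×ₖ
    Kernel.const (Vec L) Q).map (fun p => WithLp.toLp 2 (gain A σ *ᵥ p.1.ofLp) + p.2) with hκ
  have hκm : IsMarkovKernel κ := Kernel.IsMarkovKernel.map _ hg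
  have hκy : ∀ y, κ y = Q.map (fun e => WithLp.toLp 2 (gain A σ *ᵥ y.ofLp) + e) := fun y => by
    rw [hκ, Kernel.map_apply _ hg, Kernel.prod_apply, Kernel.id_apply, Kernel.const_apply,
      Measure.dirac_prod, Measure.map_map hg (by fun_prop)]
    rfl
  -- The explicit kernel disintegrates the joint law, and conditional kernels are unique almost
  -- everywhere.
  have heq : modelLaw A σ = (modelLaw A σ).fst ⊗ₘ κ := by
    refine Measure.ext_of_lintegral _ fun F hF => ?_
    have hfst : (modelLaw A σ).fst = multivariateGaussian 0 (covY A σ) := obsLaw_eq A hσ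
    have hF' : Measurable (fun p : Vec L × Vec M =>
        F (p.1, WithLp.toLp 2 (gain A σ *ᵥ p.1.ofLp) + p.2)) :=
      hF.comp (measurable_fst.prodMk hg)
    rw [Measure.lintegral_compProd hF, hfst, modelLaw_eq_map A hσ,
      lintegral_map hF (measurable_fst.prodMk hg), lintegral_prod _ hF'.aemeasurable]
    refine lintegral_congr fun y => ?_
    have hFy : Measurable (fun x => F (y, x)) := hF.comp (by fun_prop)
    rw [hκy, lintegral_map hFy (by fun_prop)]
  filter_upwards [eq_condKernel_of_measure_eq_compProd κ heq] with y hy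
  rw [posterior, ← hy, hκy]

/-- The distortion splits into the estimation error and the error with respect to the estimate. -/
lemma distortion_eq (hσ : 0 < σ) {ρ : Measure (Vec L × Vec M)} (hρ : ρ.fst = obsLaw A σ) :
    distortion A σ ρ = (M : ℝ≥0∞)⁻¹ * ∫⁻ p, ENNReal.ofReal
      (‖(WithLp.toLp 2 (gain A σ *ᵥ p.1.ofLp) : Vec M) - p.2‖ ^ 2 + (errCov A σ).trace) ∂ρ := by
  rw [distortion]
  congr 1
  refine lintegral_congr_ae ?_
  have h := posterior_ae_eq A hσ
  rw [← hρ, Measure.fst] at h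
  filter_upwards [ae_of_ae_map measurable_fst.aemeasurable h] with p hp
  rw [hp, lintegral_map (by fun_prop) (by fun_prop), ← lintegral_norm_add_sq (errCov_posSemidef A hσ)]
  refine lintegral_congr fun e => ?_
  rw [add_sub_right_comm]

end Model

/-! ### Water-filling lower bound, backward channel, and upper bound for compress-and-estimate. -/

section Bounds

variable {L M : ℕ} (A : Matrix (Fin L) (Fin M) ℝ) {σ : ℝ}

lemma mutualInfo_le_iff {α β : Type*} [MeasurableSpace α] [MeasurableSpace β]
    (ρ : Measure (α × β)) (R : ℝ) :
    mutualInfo ρ ≤ ENNReal.ofReal R ↔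
      InformationTheory.klDiv ρ (ρ.fst.prod ρ.snd) ≤ ENNReal.ofReal (R * Real.log 2) := by
  have h2 : 0 < Real.log 2 := Real.log_pos one_lt_two
  rw [mutualInfo, ENNReal.div_le_iff (by simpa using h2) ENNReal.ofReal_ne_top,
    ENNReal.ofReal_mul' h2.le]

/-- Every joint law satisfying the rate constraint has at least the reverse water-filling
distortion. -/
lemma le_distortion (hσ : 0 < σ) {R t : ℝ} (ht : 0 < t)
    (hR : R * Real.log 2 ≤
      ∑ i, 1 / 2 * Real.log (max 1 ((covEst_isHermitian A (σ := σ)).eigenvalues i / t)))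
    {ρ : Measure (Vec L × Vec M)} (hρ : ρ.fst = obsLaw A σ)
    (hI : mutualInfo ρ ≤ ENNReal.ofReal R) :
    (M : ℝ≥0∞)⁻¹ * ENNReal.ofReal
      ((errCov A σ).trace + ∑ i, min ((covEst_isHermitian A (σ := σ)).eigenvalues i) t) ≤
      distortion A σ ρ := by
  set d := (covEst_isHermitian A (σ := σ)).eigenvalues with hd
  have hdnn : ∀ i, 0 ≤ d i := (covEst_posSemidef A hσ).eigenvalues_nonneg
  obtain ⟨V, hV, hV', hdiag⟩ := exists_diagonalization (covEst_isHermitian A (σ := σ))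
  rw [← hd] at hdiag
  have hprob : IsProbabilityMeasure ρ := ⟨by
    rw [← Measure.fst_univ, hρ]; exact measure_univ⟩
  have hmul : ∀ (T : Matrix (Fin M) (Fin M) ℝ), Measurable (fun x : Vec M => T *ᵥ x.ofLp) :=
    fun T => (WithLp.measurable_ofLp 2 _).comp (measurable_toLp_mulVec T)
  set f : Vec L → (Fin M → ℝ) := fun y => (Vᵀ * gain A σ) *ᵥ y.ofLp with hf
  set g : Vec M → (Fin M → ℝ) := fun x => Vᵀ *ᵥ x.ofLp with hg
  have hfm : Measurable f := (WithLp.measurable_ofLp 2 _).comp (measurable_toLp_mulVec _)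
  have hgm : Measurable g := hmul Vᵀ
  have hfst : (ρ.map (Prod.map f g)).fst = ρ.fst.map f := by
    rw [Measure.fst, Measure.fst, Measure.map_map measurable_fst (hfm.prodMap hgm),
      Measure.map_map hfm measurable_fst]
    rfl
  have hsnd : (ρ.map (Prod.map f g)).snd = ρ.snd.map g := by
    rw [Measure.snd, Measure.snd, Measure.map_map measurable_snd (hfm.prodMap hgm),
      Measure.map_map hgm measurable_snd]
    rfl
  -- In the eigenbasis of `E` the vector `G Y` has independent Gaussian coordinates with the
  -- eigenvalues as variances, some possibly zero.
  have hlaw : ρ.fst.map f = Measure.pi fun i => gaussianReal 0 (d i).toNNReal := by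
    have h1 : (ρ.fst.map (fun y => (WithLp.toLp 2 ((Vᵀ * gain A σ) *ᵥ y.ofLp) : Vec M))) =
        (Measure.pi fun i => gaussianReal 0 (d i).toNNReal).map (WithLp.toLp 2) := by
      rw [pi_gaussianReal_map_toLp, hρ, obsLaw_eq A hσ,
        multivariateGaussian_map_mulVec (covY_posDef A hσ).posSemidef]
      congr 1
      have : Vᵀ * gain A σ * covY A σ * (Vᵀ * gain A σ)ᵀ =
          Vᵀ * (gain A σ * covY A σ * (gain A σ)ᵀ) * V := by
        simp only [Matrix.transpose_mul, Matrix.transpose_transpose, Matrix.mul_assoc]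
      rw [this, gain_mul_covY_mul_transpose A hσ, hdiag]
      have : Vᵀ * (V * diagonal d * Vᵀ) * V = (Vᵀ * V) * diagonal d * (Vᵀ * V) := by
        simp only [Matrix.mul_assoc]
      rw [this, hV, Matrix.one_mul, Matrix.mul_one]
      congr 1
      ext i
      rw [Real.coe_toNNReal _ (hdnn i)]
    have h2 := congrArg (fun μ : Measure (Vec M) => μ.map (WithLp.ofLp)) h1
    simp only at h2
    rw [Measure.map_map (WithLp.measurable_ofLp 2 _) (measurable_toLp_mulVec _),
      Measure.map_map (WithLp.measurable_ofLp 2 _) (WithLp.measurable_toLp 2 _)] at h2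
    have h3 : (WithLp.ofLp : Vec M → (Fin M → ℝ)) ∘ (WithLp.toLp 2) = id := rfl
    rw [h3, Measure.map_id] at h2
    exact h2
  have hprob' : IsProbabilityMeasure (ρ.map (Prod.map f g)) :=
    Measure.isProbabilityMeasure_map (hfm.prodMap hgm).aemeasurable
  have hkl : InformationTheory.klDiv (ρ.map (Prod.map f g))
      ((ρ.map (Prod.map f g)).fst.prod (ρ.map (Prod.map f g)).snd) ≤
      ENNReal.ofReal (∑ i, 1 / 2 * Real.log (max 1 (((d i).toNNReal : ℝ) / (t.toNNReal : ℝ)))) := by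
    rw [hfst, hsnd]
    refine (klDiv_map_prodMap_le ρ ρ.fst ρ.snd hfm hgm).trans
      (((mutualInfo_le_iff ρ R).1 hI).trans (ENNReal.ofReal_le_ofReal ?_))
    simp_rw [fun i => Real.coe_toNNReal _ (hdnn i), Real.coe_toNNReal _ ht.le]
    exact hR
  have hmain := sum_min_le_lintegral_of_klDiv_le (by simpa using ht) (hfst.trans hlaw) hkl
  have hsum : Measurable (fun p : (Fin M → ℝ) × (Fin M → ℝ) =>
      ENNReal.ofReal (∑ i, (p.1 i - p.2 i) ^ 2)) := by fun_prop
  rw [lintegral_map hsum (hfm.prodMap hgm)] at hmain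
  simp_rw [fun i => Real.coe_toNNReal _ (hdnn i), Real.coe_toNNReal _ ht.le] at hmain
  -- The rotation `Vᵀ` preserves the squared error.
  have hnorm : ∀ p : Vec L × Vec M, ∑ i, ((Prod.map f g p).1 i - (Prod.map f g p).2 i) ^ 2 =
      ‖(WithLp.toLp 2 (gain A σ *ᵥ p.1.ofLp) : Vec M) - p.2‖ ^ 2 := fun p => by
    set w := (WithLp.toLp 2 (gain A σ *ᵥ p.1.ofLp) : Vec M) - p.2 with hw
    have h1 : ∀ i, (Prod.map f g p).1 i - (Prod.map f g p).2 i = (Vᵀ *ᵥ w.ofLp) i := fun i => by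
      rw [hw, WithLp.ofLp_sub, Matrix.mulVec_sub, Pi.sub_apply, Matrix.mulVec_mulVec]
      rfl
    simp_rw [h1]
    have h2 : ∑ i, (Vᵀ *ᵥ w.ofLp) i ^ 2 = (Vᵀ *ᵥ w.ofLp) ⬝ᵥ (Vᵀ *ᵥ w.ofLp) := by
      simp only [dotProduct, sq]
    rw [h2, Matrix.dotProduct_mulVec, ← Matrix.mulVec_transpose, Matrix.transpose_transpose,
      Matrix.mulVec_mulVec, hV', Matrix.one_mulVec, EuclideanSpace.real_norm_sq_eq]
    simp only [dotProduct, sq]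
  simp_rw [hnorm] at hmain
  rw [distortion_eq A hσ hρ]
  gcongr
  have htr : 0 ≤ (errCov A σ).trace := (errCov_posSemidef A hσ).trace_nonneg
  simp_rw [fun p : Vec L × Vec M => ENNReal.ofReal_add
    (sq_nonneg ‖(WithLp.toLp 2 (gain A σ *ᵥ p.1.ofLp) : Vec M) - p.2‖) htr]
  rw [lintegral_add_right _ measurable_const, lintegral_const, measure_univ, mul_one, add_comm,
    ENNReal.ofReal_add (Finset.sum_nonneg fun i _ => le_min (hdnn i) ht.le) htr]
  gcongr

/-- The water level is positive and attains the rate. -/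
lemma waterLevel_spec (hL : 0 < L) (hσ : 0 < σ) {R : ℝ} (hR : 0 ≤ R) :
    0 < waterLevel A σ R ∧ ∑ l ∈ Finset.Icc 1 L,
      1 / 2 * Real.logb 2 (max 1 (eig (covY A σ) l / waterLevel A σ R)) = R := by
  set h : ℝ → ℝ := fun t =>
    ∑ l ∈ Finset.Icc 1 L, 1 / 2 * Real.logb 2 (max 1 (eig (covY A σ) l / t)) with hh
  set m := eig (covY A σ) 1 with hm
  have hm0 : 0 < m := by
    rw [hm, eig_covY A le_rfl hL]
    have := spec_nonneg A 1
    positivity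
  have hnn : ∀ t, ∀ l ∈ Finset.Icc 1 L,
      0 ≤ 1 / 2 * Real.logb 2 (max 1 (eig (covY A σ) l / t)) := fun t l _ =>
    mul_nonneg (by norm_num) (Real.logb_nonneg one_lt_two (le_max_left _ _))
  have hge : ∀ t, 0 < t → 1 / 2 * Real.logb 2 (m / t) ≤ h t := fun t ht =>
    calc 1 / 2 * Real.logb 2 (m / t) ≤ 1 / 2 * Real.logb 2 (max 1 (m / t)) := by
          have : Real.logb 2 (m / t) ≤ Real.logb 2 (max 1 (m / t)) :=
            Real.logb_le_logb_of_le one_lt_two (by positivity) (le_max_right _ _)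
          linarith
      _ ≤ h t := Finset.single_le_sum (hnn t) (Finset.mem_Icc.2 ⟨le_rfl, hL⟩)
  have hcont : ContinuousOn h (Set.Ioi 0) := by
    refine continuousOn_finsetSum _ fun l _ => continuousOn_const.mul ?_
    refine ContinuousOn.div_const (ContinuousOn.log ?_ ?_) _
    · exact continuousOn_const.sup (continuousOn_const.div continuousOn_id fun t ht => ne_of_gt ht)
    · intro t _
      exact ne_of_gt (zero_lt_one.trans_le (le_max_left _ _))
  -- At level `e` the top component alone uses rate `R`; hence no solution lies below `e`, and the
  -- rate at `e` is at least `R`.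
  set e := m * (2 : ℝ) ^ (-(2 * R)) with he
  have he0 : 0 < e := by positivity
  have hem : e ≤ m := by
    have : (2 : ℝ) ^ (-(2 * R)) ≤ 1 := Real.rpow_le_one_of_one_le_of_nonpos (by norm_num) (by linarith)
    nlinarith
  have hRe : R = 1 / 2 * Real.logb 2 (m / e) := by
    have : m / e = (2 : ℝ) ^ (2 * R) := by
      rw [he, Real.rpow_neg (by norm_num)]
      field_simp
    rw [this, Real.logb_rpow (by norm_num) (by norm_num)]
    ring
  have hhm : h m = 0 := by
    refine Finset.sum_eq_zero fun l hl => ?_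
    rw [Finset.mem_Icc] at hl
    have : eig (covY A σ) l / m ≤ 1 :=
      (div_le_one hm0).2 (eig_le_eig (covY_isHermitian A σ) le_rfl hl.1 hl.2)
    rw [max_eq_left this, Real.logb_one, mul_zero]
  set S := {t : ℝ | 0 < t ∧ h t = R} with hS
  -- Bounding the solutions away from `0` makes the set closed, so the infimum is attained.
  have hSe : S = Set.Ici e ∩ h ⁻¹' {R} := by
    ext t
    constructor
    · rintro ⟨ht0, ht⟩
      refine ⟨?_, ht⟩
      by_contra hc
      have hc : t < e := not_le.1 hc
      have h1 := hge t ht0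
      have h2 : Real.logb 2 (m / e) < Real.logb 2 (m / t) :=
        Real.logb_lt_logb one_lt_two (by positivity) (by gcongr)
      linarith
    · rintro ⟨h1, h2⟩
      exact ⟨he0.trans_le h1, h2⟩
  have hclosed : IsClosed S := by
    rw [hSe]
    exact (hcont.mono fun t (ht : e ≤ t) => he0.trans_le ht).preimage_isClosed_of_isClosed
      isClosed_Ici isClosed_singleton
  have hne : S.Nonempty := by
    -- The rate is `0` at the largest eigenvalue and at least `R` at `e`.
    have hivt := intermediate_value_Icc' hem (hcont.mono fun t ht => he0.trans_le ht.1)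
    rw [hhm] at hivt
    obtain ⟨t, ht, htR⟩ := hivt ⟨hR, hRe.le.trans (hge e he0)⟩
    exact ⟨t, he0.trans_le ht.1, htR⟩
  exact hclosed.csInf_mem hne ⟨0, fun t ht => ht.1.le⟩

lemma waterLevel_pos (hL : 0 < L) (hσ : 0 < σ) {R : ℝ} (hR : 0 ≤ R) : 0 < waterLevel A σ R :=
  (waterLevel_spec A hL hσ hR).1

/-- The eigenvectors of `Σ_Y`. -/
noncomputable def eigMatrix (A : Matrix (Fin L) (Fin M) ℝ) (σ : ℝ) : Matrix (Fin L) (Fin L) ℝ :=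
  (covY_isHermitian A σ).eigenvectorUnitary

lemma eigMatrix_transpose_mul : (eigMatrix A σ)ᵀ * eigMatrix A σ = 1 := by
  have := Unitary.coe_star_mul_self (covY_isHermitian A σ).eigenvectorUnitary
  simpa [eigMatrix, Matrix.star_eq_conjTranspose] using this

lemma eigMatrix_mul_transpose : eigMatrix A σ * (eigMatrix A σ)ᵀ = 1 := by
  have := Unitary.coe_mul_star_self (covY_isHermitian A σ).eigenvectorUnitary
  simpa [eigMatrix, Matrix.star_eq_conjTranspose] using this

lemma covY_eq : covY A σ =
    eigMatrix A σ * Matrix.diagonal (covY_isHermitian A σ).eigenvalues * (eigMatrix A σ)ᵀ := by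
  have := (covY_isHermitian A σ).spectral_theorem
  rw [Unitary.conjStarAlgAut_apply] at this
  simpa [eigMatrix, Matrix.star_eq_conjTranspose] using this

lemma conj_mul_conj (d e : Fin L → ℝ) :
    (eigMatrix A σ * Matrix.diagonal d * (eigMatrix A σ)ᵀ) *
      (eigMatrix A σ * Matrix.diagonal e * (eigMatrix A σ)ᵀ) =
      eigMatrix A σ * Matrix.diagonal (fun i => d i * e i) * (eigMatrix A σ)ᵀ := by
  set U := eigMatrix A σ with hU
  calc U * diagonal d * Uᵀ * (U * diagonal e * Uᵀ)
      = U * (diagonal d * (Uᵀ * U) * diagonal e) * Uᵀ := by simp only [Matrix.mul_assoc]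
    _ = _ := by
      rw [hU, eigMatrix_transpose_mul, Matrix.mul_one, Matrix.diagonal_mul_diagonal]

lemma trace_conj (d : Fin L → ℝ) :
    (eigMatrix A σ * Matrix.diagonal d * (eigMatrix A σ)ᵀ).trace = ∑ i, d i := by
  rw [Matrix.trace_mul_comm, ← Matrix.mul_assoc, eigMatrix_transpose_mul, Matrix.one_mul,
    Matrix.trace_diagonal]

lemma backwardNoiseCov_eq (R : ℝ) : backwardNoiseCov A σ R = eigMatrix A σ * Matrix.diagonal
    (fun i => min ((covY_isHermitian A σ).eigenvalues i) (waterLevel A σ R)) * (eigMatrix A σ)ᵀ :=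
  rfl

lemma covY_sub_backwardNoiseCov_eq (R : ℝ) : covY A σ - backwardNoiseCov A σ R =
    eigMatrix A σ * Matrix.diagonal (fun i => (covY_isHermitian A σ).eigenvalues i -
      min ((covY_isHermitian A σ).eigenvalues i) (waterLevel A σ R)) * (eigMatrix A σ)ᵀ := by
  have : (Matrix.diagonal (fun i => (covY_isHermitian A σ).eigenvalues i -
      min ((covY_isHermitian A σ).eigenvalues i) (waterLevel A σ R))) =
      Matrix.diagonal (covY_isHermitian A σ).eigenvalues - Matrix.diagonal (fun i =>
      min ((covY_isHermitian A σ).eigenvalues i) (waterLevel A σ R)) :=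
    (Matrix.diagonal_sub _ _).symm
  rw [this, mul_sub, sub_mul, ← covY_eq, ← backwardNoiseCov_eq]

lemma conj_posSemidef {d : Fin L → ℝ} (hd : ∀ i, 0 ≤ d i) :
    (eigMatrix A σ * Matrix.diagonal d * (eigMatrix A σ)ᵀ).PosSemidef := by
  have := (Matrix.PosSemidef.diagonal hd).mul_mul_conjTranspose_same (eigMatrix A σ)
  rwa [Matrix.conjTranspose_eq_transpose_of_trivial] at this

lemma eigenvalues_covY_pos (hσ : 0 < σ) (i : Fin L) : 0 < (covY_isHermitian A σ).eigenvalues i :=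
  lt_of_lt_of_le (by positivity) (eigenvalues_covY_ge A i)

lemma backwardNoiseCov_posSemidef (hL : 0 < L) (hσ : 0 < σ) {R : ℝ} (hR : 0 ≤ R) :
    (backwardNoiseCov A σ R).PosSemidef := by
  rw [backwardNoiseCov_eq]
  exact conj_posSemidef A fun i =>
    le_min (eigenvalues_covY_pos A hσ i).le (waterLevel_pos A hL hσ hR).le

lemma covY_sub_backwardNoiseCov_posSemidef (R : ℝ) :
    (covY A σ - backwardNoiseCov A σ R).PosSemidef := by
  rw [covY_sub_backwardNoiseCov_eq]
  exact conj_posSemidef A fun i => sub_nonneg.2 (min_le_left _ _)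

lemma measurable_ceLaw_map :
    Measurable (fun p : Vec L × Vec L => (p.1 + p.2, p.1)) := by fun_prop

instance (R : ℝ) : IsProbabilityMeasure (ceLaw A σ R) :=
  Measure.isProbabilityMeasure_map measurable_ceLaw_map.aemeasurable

lemma ceLaw_fst (hL : 0 < L) (hσ : 0 < σ) {R : ℝ} (hR : 0 ≤ R) :
    (ceLaw A σ R).fst = obsLaw A σ := by
  rw [ceLaw, Measure.fst, Measure.map_map measurable_fst measurable_ceLaw_map, obsLaw_eq A hσ]
  have := multivariateGaussian_conv (covY_sub_backwardNoiseCov_posSemidef A (σ := σ) R)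
    (backwardNoiseCov_posSemidef A hL hσ hR)
  rw [sub_add_cancel] at this
  exact this

lemma ceLaw_map_fst (hL : 0 < L) (hσ : 0 < σ) {R : ℝ} (hR : 0 ≤ R) {g : Vec L → Vec M}
    (hg : Measurable g) :
    ((ceLaw A σ R).map (fun p => (p.1, g p.2))).fst = obsLaw A σ := by
  have hgm : Measurable (fun p : Vec L × Vec L => (p.1, g p.2)) :=
    measurable_fst.prodMk (hg.comp measurable_snd)
  rw [← ceLaw_fst A hL hσ hR, Measure.fst, Measure.map_map measurable_fst hgm]
  rfl

/-- In the eigenbasis of `Σ_Y` the backward channel splits into parallel scalar channels, with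
information `∑ (1/2) log (d_i / min(d_i, θ))`. This is the water-filling rate in nats, and applying
`g` cannot increase it. -/
lemma mutualInfo_ceLaw_map_le (hL : 0 < L) (hσ : 0 < σ) {R : ℝ} (hR : 0 ≤ R) {g : Vec L → Vec M}
    (hg : Measurable g) :
    mutualInfo ((ceLaw A σ R).map (fun p => (p.1, g p.2))) ≤ ENNReal.ofReal R := by
  obtain ⟨ht, hrate⟩ := waterLevel_spec A hL hσ hR
  set t := waterLevel A σ R with htdef
  set d := (covY_isHermitian A σ).eigenvalues with hd
  have hd0 : ∀ i, 0 < d i := eigenvalues_covY_pos A hσ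
  set U := eigMatrix A σ with hU
  set a : Fin L → NNReal := fun i => (d i - min (d i) t).toNNReal with ha
  set b : Fin L → NNReal := fun i => (min (d i) t).toNNReal with hb
  have haR : ∀ i, (a i : ℝ) = d i - min (d i) t := fun i =>
    Real.coe_toNNReal _ (sub_nonneg.2 (min_le_left _ _))
  have hbpos : ∀ i, 0 < min (d i) t := fun i => lt_min (hd0 i) ht
  have hbR : ∀ i, (b i : ℝ) = min (d i) t := fun i => Real.coe_toNNReal _ (hbpos i).le
  have hb0 : ∀ i, b i ≠ 0 := fun i => (Real.toNNReal_pos.2 (hbpos i)).ne'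
  have hUm : Measurable (fun x : Fin L → ℝ => (WithLp.toLp 2 (U *ᵥ x) : Vec L)) :=
    (measurable_toLp_mulVec U).comp (WithLp.measurable_toLp 2 _)
  set f : (Fin L → ℝ) → Vec L := fun x => WithLp.toLp 2 (U *ᵥ x) with hf
  set Pa := Measure.pi fun i => gaussianReal 0 (a i) with hPa
  set Pb := Measure.pi fun i => gaussianReal 0 (b i) with hPb
  set Pm := Measure.pi fun i => gaussianReal 0 (a i + b i) with hPm
  have hPaf : Pa.map f = multivariateGaussian 0 (covY A σ - backwardNoiseCov A σ R) := by
    rw [hPa, pi_gaussianReal_map_mulVec, covY_sub_backwardNoiseCov_eq]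
    simp_rw [haR]
    rfl
  have hPbf : Pb.map f = multivariateGaussian 0 (backwardNoiseCov A σ R) := by
    rw [hPb, pi_gaussianReal_map_mulVec, backwardNoiseCov_eq]
    simp_rw [hbR]
    rfl
  have hPmf : Pm.map f = obsLaw A σ := by
    rw [hPm, pi_gaussianReal_map_mulVec, obsLaw_eq A hσ, covY_eq]
    simp_rw [NNReal.coe_add, haR, hbR, sub_add_cancel]
    rfl
  have hadd : Measurable (fun p : (Fin L → ℝ) × (Fin L → ℝ) => (p.1 + p.2, p.1)) := by fun_prop
  have hgm : Measurable (fun p : Vec L × Vec L => (p.1, g p.2)) :=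
    measurable_fst.prodMk (hg.comp measurable_snd)
  have hlaw : (ceLaw A σ R).map (fun p => (p.1, g p.2)) =
      ((Pa.prod Pb).map (fun p : (Fin L → ℝ) × (Fin L → ℝ) => (p.1 + p.2, p.1))).map
        (Prod.map f (g ∘ f)) := by
    rw [ceLaw, ← hPaf, ← hPbf, Measure.map_prod_map _ _ hUm hUm,
      Measure.map_map measurable_ceLaw_map (hUm.prodMap hUm), Measure.map_map hgm
        (measurable_ceLaw_map.comp (hUm.prodMap hUm)),
      Measure.map_map (hUm.prodMap (hg.comp hUm)) hadd]
    congr 1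
    funext p
    simp only [Function.comp_apply, Prod.map, hf, Matrix.mulVec_add, WithLp.toLp_add]
  have hsnd : ((ceLaw A σ R).map (fun p => (p.1, g p.2))).snd = Pa.map (g ∘ f) := by
    rw [hlaw, Measure.snd, Measure.map_map measurable_snd (hUm.prodMap (hg.comp hUm)),
      Measure.map_map (measurable_snd.comp (hUm.prodMap (hg.comp hUm))) hadd]
    have : (Pa.prod Pb).map Prod.fst = Pa := Measure.fst_prod
    conv_rhs => rw [← this]
    rw [Measure.map_map (hg.comp hUm) measurable_fst]
    rfl
  rw [mutualInfo_le_iff, hsnd, ceLaw_map_fst A hL hσ hR hg, ← hPmf, hlaw]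
  have : IsProbabilityMeasure
      ((Pa.prod Pb).map (fun p : (Fin L → ℝ) × (Fin L → ℝ) => (p.1 + p.2, p.1))) :=
    Measure.isProbabilityMeasure_map hadd.aemeasurable
  refine (klDiv_map_prodMap_le _ _ _ hUm (hg.comp hUm)).trans
    ((klDiv_add_pi_gaussianReal_le a b hb0).trans (ENNReal.ofReal_le_ofReal (le_of_eq ?_)))
  have h2 : Real.log 2 ≠ 0 := (Real.log_pos one_lt_two).ne'
  rw [← hrate, sum_eig (covY_isHermitian A σ) (fun x => 1 / 2 * Real.logb 2 (max 1 (x / t))),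
    Finset.sum_mul]
  refine Finset.sum_congr rfl fun i _ => ?_
  rw [haR, hbR, sub_add_cancel, ← hd, Real.logb, mul_assoc, div_mul_cancel₀ _ h2]
  congr 2
  rcases le_total (d i) t with h | h
  · rw [min_eq_left h, div_self (hd0 i).ne', max_eq_left ((div_le_one ht).2 h)]
  · rw [min_eq_right h, max_eq_right ((one_le_div ht).2 h)]

lemma iDRF_le_ceDRF (hL : 0 < L) (hσ : 0 < σ) {R : ℝ} (hR : 0 ≤ R) :
    iDRF A σ R ≤ ceDRF A σ R :=
  le_iInf₂ fun _ hg => iInf₂_le _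
    ⟨ceLaw_map_fst A hL hσ hR hg, mutualInfo_ceLaw_map_le A hL hσ hR hg⟩

/-- By cyclicity of the trace only `A Aᵀ`, `Σ_Y⁻¹` and `Σ_N` occur, and these are diagonal in one
basis. -/
lemma trace_gain_mul_backwardNoiseCov (hσ : 0 < σ) (R : ℝ) :
    (gain A σ * backwardNoiseCov A σ R * (gain A σ)ᵀ).trace =
      ∑ i, ((covY_isHermitian A σ).eigenvalues i - σ ^ 2) /
        (covY_isHermitian A σ).eigenvalues i ^ 2 *
        min ((covY_isHermitian A σ).eigenvalues i) (waterLevel A σ R) := by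
  set d := (covY_isHermitian A σ).eigenvalues with hd
  have hd0 : ∀ i, 0 < d i := eigenvalues_covY_pos A hσ
  set U := eigMatrix A σ with hU
  have hinv : (covY A σ)⁻¹ = U * Matrix.diagonal (fun i => (d i)⁻¹) * Uᵀ := by
    refine Matrix.inv_eq_right_inv ?_
    rw [covY_eq, conj_mul_conj]
    simp_rw [← hd, fun i => mul_inv_cancel₀ (hd0 i).ne']
    rw [Matrix.diagonal_one, Matrix.mul_one, eigMatrix_mul_transpose]
  have hAA : A * Aᵀ = U * Matrix.diagonal (fun i => d i - σ ^ 2) * Uᵀ := by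
    have h1 : Matrix.diagonal (fun i => d i - σ ^ 2) = Matrix.diagonal d -
        σ ^ 2 • (1 : Matrix (Fin L) (Fin L) ℝ) := by
      ext i j
      by_cases hij : i = j <;> simp [Matrix.diagonal, hij]
    have h2 : A * Aᵀ = covY A σ - σ ^ 2 • (1 : Matrix (Fin L) (Fin L) ℝ) := by simp [covY]
    rw [h2, h1, mul_sub, sub_mul, Matrix.mul_smul, Matrix.mul_one, Matrix.smul_mul,
      eigMatrix_mul_transpose, ← covY_eq]
  have hexp : (gain A σ * backwardNoiseCov A σ R * (gain A σ)ᵀ).trace =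
      ((A * Aᵀ) * (covY A σ)⁻¹ * backwardNoiseCov A σ R * (covY A σ)⁻¹).trace := by
    rw [gain, Matrix.transpose_mul, Matrix.transpose_transpose, Matrix.transpose_nonsing_inv,
      covY_transpose, ← Matrix.mul_assoc, Matrix.trace_mul_comm]
    simp only [Matrix.mul_assoc]
  rw [hexp, hAA, hinv, backwardNoiseCov_eq, conj_mul_conj, conj_mul_conj, conj_mul_conj,
    trace_conj]
  refine Finset.sum_congr rfl fun i _ => ?_
  have := (hd0 i).ne'
  rw [← hd]
  field_simp

/-- The estimator is `G Ŷ`, and `G Y - G Ŷ = G N` has mean square `tr (G Σ_N Gᵀ)`. Its optimality is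
not needed. -/
lemma ceDRF_le (hL : 0 < L) (hσ : 0 < σ) {R : ℝ} (hR : 0 ≤ R) :
    ceDRF A σ R ≤ (M : ℝ≥0∞)⁻¹ * ENNReal.ofReal ((errCov A σ).trace +
      ∑ i, ((covY_isHermitian A σ).eigenvalues i - σ ^ 2) /
        (covY_isHermitian A σ).eigenvalues i ^ 2 *
        min ((covY_isHermitian A σ).eigenvalues i) (waterLevel A σ R)) := by
  have hg : Measurable (fun y : Vec L => (WithLp.toLp 2 (gain A σ *ᵥ y.ofLp) : Vec M)) :=
    measurable_toLp_mulVec _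
  refine (iInf₂_le _ hg).trans ?_
  rw [distortion_eq A hσ (ceLaw_map_fst A hL hσ hR hg), ← trace_gain_mul_backwardNoiseCov A hσ]
  gcongr
  have hN := backwardNoiseCov_posSemidef A hL hσ hR
  have hBN : (gain A σ * backwardNoiseCov A σ R * (gain A σ)ᵀ).PosSemidef := by
    have := hN.mul_mul_conjTranspose_same (gain A σ)
    rwa [Matrix.conjTranspose_eq_transpose_of_trivial] at this
  have htr : 0 ≤ (errCov A σ).trace := (errCov_posSemidef A hσ).trace_nonneg
  have hF : Measurable (fun p : Vec L × Vec M => ENNReal.ofReal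
      (‖(WithLp.toLp 2 (gain A σ *ᵥ p.1.ofLp) : Vec M) - p.2‖ ^ 2 + (errCov A σ).trace)) :=
    ((((hg.comp measurable_fst).sub measurable_snd).norm.pow_const 2).add_const _).ennreal_ofReal
  have hgm : Measurable (fun p : Vec L × Vec L =>
      (p.1, (WithLp.toLp 2 (gain A σ *ᵥ p.2.ofLp) : Vec M))) :=
    measurable_fst.prodMk (hg.comp measurable_snd)
  rw [ceLaw, Measure.map_map hgm measurable_ceLaw_map,
    lintegral_map hF (hgm.comp measurable_ceLaw_map)]
  have hsimp : ∀ p : Vec L × Vec L,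
      (WithLp.toLp 2 (gain A σ *ᵥ (p.1 + p.2).ofLp) : Vec M) - WithLp.toLp 2 (gain A σ *ᵥ p.1.ofLp)
        = WithLp.toLp 2 (gain A σ *ᵥ p.2.ofLp) := fun p => by
    rw [WithLp.ofLp_add, Matrix.mulVec_add, WithLp.toLp_add, add_sub_cancel_left]
  simp only [Function.comp_apply, hsimp]
  have hF2 : Measurable (fun x : Vec M => ENNReal.ofReal (‖0 + x‖ ^ 2)) := by fun_prop
  have hsec := lintegral_norm_add_sq hBN 0
  rw [← multivariateGaussian_map_mulVec hN, lintegral_map hF2 hg] at hsec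
  simp only [zero_add, norm_zero, ne_eq, OfNat.ofNat_ne_zero, not_false_eq_true, zero_pow] at hsec
  have hsplit : ∀ p : Vec L × Vec L, ENNReal.ofReal
      (‖(WithLp.toLp 2 (gain A σ *ᵥ p.2.ofLp) : Vec M)‖ ^ 2 + (errCov A σ).trace) =
      ENNReal.ofReal (‖(WithLp.toLp 2 (gain A σ *ᵥ p.2.ofLp) : Vec M)‖ ^ 2) +
        ENNReal.ofReal (errCov A σ).trace := fun p => ENNReal.ofReal_add (sq_nonneg _) htr
  simp_rw [hsplit]
  rw [lintegral_add_right _ measurable_const, lintegral_const, measure_univ, mul_one,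
    measurePreserving_snd.lintegral_comp (g := Prod.snd)
      (f := fun y : Vec L => ENNReal.ofReal (‖(WithLp.toLp 2 (gain A σ *ᵥ y.ofLp) : Vec M)‖ ^ 2))
      ((hg.norm.pow_const 2).ennreal_ofReal), hsec, add_comm,
    ENNReal.ofReal_add htr hBN.trace_nonneg]

end Bounds

/-! ### Rate thresholds and water levels. -/

section Thresholds

lemma rateThreshold_eq {n : ℕ} {C : Matrix (Fin n) (Fin n) ℝ} {k : ℕ} (hk : k ≤ C.rank)
    (h1 : eig C 1 ≠ 0) : rateThreshold C k =
      ((1 / 2 * ∑ l ∈ Finset.Icc 1 k, Real.logb 2 (eig C l / eig C k) : ℝ) : EReal) := by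
  unfold rateThreshold
  split_ifs with h
  · subst h
    simp [div_self h1]
  · rfl

/-- If the water-filling rate of level `τ` on the first `j` values exceeds neither `R` nor the
threshold of the next value, then the next value is below the level. -/
lemma le_level {a : ℕ → ℝ} {τ R : ℝ} {j : ℕ} (hj : 1 ≤ j) (ha : ∀ l ∈ Finset.Icc 1 (j + 1), 0 < a l)
    (hτ : 0 < τ) (hR : R ≤ 1 / 2 * ∑ l ∈ Finset.Icc 1 (j + 1), Real.logb 2 (a l / a (j + 1)))
    (hτR : ∑ l ∈ Finset.Icc 1 j, 1 / 2 * Real.logb 2 (max 1 (a l / τ)) ≤ R) : a (j + 1) ≤ τ := by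
  by_contra hc
  have hc : τ < a (j + 1) := not_le.1 hc
  have hpos : 0 < a (j + 1) := hτ.trans hc
  rw [Finset.sum_Icc_succ_top (by omega), div_self hpos.ne', Real.logb_one, add_zero,
    Finset.mul_sum] at hR
  have hlt : ∑ l ∈ Finset.Icc 1 j, 1 / 2 * Real.logb 2 (a l / a (j + 1)) <
      ∑ l ∈ Finset.Icc 1 j, 1 / 2 * Real.logb 2 (max 1 (a l / τ)) := by
    refine Finset.sum_lt_sum_of_nonempty ⟨1, Finset.mem_Icc.2 ⟨le_rfl, hj⟩⟩ fun l hl => ?_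
    have hl' : 0 < a l := ha l (by simp only [Finset.mem_Icc] at hl ⊢; omega)
    have h1 : Real.logb 2 (a l / a (j + 1)) < Real.logb 2 (max 1 (a l / τ)) :=
      Real.logb_lt_logb one_lt_two (by positivity)
        ((by gcongr : a l / a (j + 1) < a l / τ).trans_le (le_max_right _ _))
    linarith
  linarith

/-- Raising the index lowers the denominators and adds nonnegative terms. -/
lemma threshold_mono {a : ℕ → ℝ} {k k' : ℕ} (h1 : 1 ≤ k) (hkk : k ≤ k')
    (ha : ∀ l ∈ Finset.Icc 1 k', 0 < a l) (hanti : ∀ i j, 1 ≤ i → i ≤ j → j ≤ k' → a j ≤ a i) :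
    1 / 2 * ∑ l ∈ Finset.Icc 1 k, Real.logb 2 (a l / a k) ≤
      1 / 2 * ∑ l ∈ Finset.Icc 1 k', Real.logb 2 (a l / a k') := by
  have hk' : 0 < a k' := ha k' (Finset.mem_Icc.2 ⟨by omega, le_rfl⟩)
  have hk : 0 < a k := ha k (Finset.mem_Icc.2 ⟨h1, hkk⟩)
  refine mul_le_mul_of_nonneg_left ?_ (by norm_num)
  calc ∑ l ∈ Finset.Icc 1 k, Real.logb 2 (a l / a k)
      ≤ ∑ l ∈ Finset.Icc 1 k, Real.logb 2 (a l / a k') := by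
        refine Finset.sum_le_sum fun l hl => ?_
        have hl' : 0 < a l := ha l (by simp only [Finset.mem_Icc] at hl ⊢; omega)
        refine Real.logb_le_logb_of_le one_lt_two (by positivity) ?_
        have := hanti k k' h1 hkk le_rfl
        gcongr
    _ ≤ ∑ l ∈ Finset.Icc 1 k', Real.logb 2 (a l / a k') := by
        refine Finset.sum_le_sum_of_subset_of_nonneg (Finset.Icc_subset_Icc_right hkk)
          fun l hl _ => Real.logb_nonneg one_lt_two ?_
        rw [Finset.mem_Icc] at hl
        exact (one_le_div hk').2 (hanti l k' hl.1 hl.2 le_rfl)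

end Thresholds

/-! ### Equality at small rates. -/

section SmallRates

variable {L M : ℕ} (A : Matrix (Fin L) (Fin M) ℝ) {σ : ℝ}

lemma eig_covY_pos (hσ : 0 < σ) {l : ℕ} (h1 : 1 ≤ l) (hl : l ≤ L) : 0 < eig (covY A σ) l := by
  rw [eig_covY A h1 hl]
  have := spec_nonneg A l
  positivity

lemma eig_covEst_pos (hA : A.rank = min L M) (hσ : 0 < σ) {l : ℕ} (h1 : 1 ≤ l)
    (hl : l ≤ min L M) : 0 < eig (covEst A σ) l := by
  rw [eig_covEst A hA hσ h1 (by omega)]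
  have := (spec_pos_iff A hA h1).2 hl
  positivity

/-- The components with the largest ratio are active. -/
lemma le_min_of_ratio_eq (hL : 0 < L) (hM : 0 < M) (hA : A.rank = min L M) (hσ : 0 < σ) {k : ℕ}
    (h1 : 1 ≤ k) (hk : spec A k / (spec A k + σ ^ 2) ^ 2 = spec A 1 / (spec A 1 + σ ^ 2) ^ 2) :
    k ≤ min L M := by
  have hs : 0 < spec A 1 := (spec_pos_iff A hA le_rfl).2 (by omega)
  by_contra hc
  rw [spec_eq_zero A hA h1 (not_le.1 hc), zero_div] at hk
  have : 0 < spec A 1 / (spec A 1 + σ ^ 2) ^ 2 := by positivity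
  exact this.ne hk

/-- `λ / (λ + σ²)` is `λ / (λ + σ²)²` times `λ + σ²`: a common ratio makes the two spectra
proportional. -/
lemma eig_covEst_eq_mul (hA : A.rank = min L M) (hσ : 0 < σ) {c : ℝ} {l : ℕ} (h1 : 1 ≤ l)
    (hl : l ≤ min L M) (hc : spec A l / (spec A l + σ ^ 2) ^ 2 = c) :
    eig (covEst A σ) l = c * eig (covY A σ) l := by
  rw [eig_covEst A hA hσ h1 (by omega), eig_covY A h1 (by omega), ← hc]
  have : 0 < spec A l + σ ^ 2 := by
    have := spec_nonneg A l
    positivity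
  field_simp

variable {r₀ : ℕ}

lemma ceDRF_eq_iDRF (hL : 0 < L) (hA : A.rank = min L M) (hσ : 0 < σ)
    (h1 : 1 ≤ r₀) (hr : r₀ ≤ min L M)
    (hratio : ∀ l ∈ Finset.Icc 1 r₀,
      spec A l / (spec A l + σ ^ 2) ^ 2 = spec A 1 / (spec A 1 + σ ^ 2) ^ 2)
    {R : ℝ} (hR : 0 ≤ R) (hRY : (R : EReal) ≤ rateThreshold (covY A σ) (r₀ + 1))
    (hRE : (R : EReal) ≤ rateThreshold (covEst A σ) (r₀ + 1)) :
    ceDRF A σ R = iDRF A σ R := by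
  refine le_antisymm ?_ (iDRF_le_ceDRF A hL hσ hR)
  obtain ⟨ht, hrate⟩ := waterLevel_spec A hL hσ hR
  have hce := ceDRF_le A hL hσ hR
  set t := waterLevel A σ R
  set c := spec A 1 / (spec A 1 + σ ^ 2) ^ 2 with hc
  have hs : 0 < spec A 1 := (spec_pos_iff A hA le_rfl).2 (by omega)
  have hc0 : 0 < c := by positivity
  have hct : 0 < c * t := mul_pos hc0 ht
  set μ := eig (covY A σ) with hμ
  set ν := eig (covEst A σ) with hν
  have hμpos : ∀ l, 1 ≤ l → l ≤ L → 0 < μ l := fun l h h' => eig_covY_pos A hσ h h'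
  have hνpos : ∀ l, 1 ≤ l → l ≤ min L M → 0 < ν l := fun l h h' => eig_covEst_pos A hA hσ h h'
  have hνμ : ∀ l ∈ Finset.Icc 1 r₀, ν l = c * μ l := fun l hl => by
    have hl' := Finset.mem_Icc.1 hl
    exact eig_covEst_eq_mul A hA hσ hl'.1 (by omega) (hratio l hl)
  have hnn : ∀ (x : ℝ), 0 ≤ 1 / 2 * Real.logb 2 (max 1 x) := fun x =>
    mul_nonneg (by norm_num) (Real.logb_nonneg one_lt_two (le_max_left _ _))
  -- The threshold of index `r₀ + 1` puts every later component of `Σ_Y` under the level; for `r₀ =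
  -- L` there is none.
  have hμle : ∀ l, r₀ < l → l ≤ L → μ l ≤ t := fun l hl hlL => by
    refine (eig_le_eig (covY_isHermitian A σ) (by omega : 1 ≤ r₀ + 1) hl hlL).trans ?_
    rw [rateThreshold_eq (by rw [rank_covY A hσ]; omega) (hμpos 1 le_rfl hL).ne',
      EReal.coe_le_coe_iff] at hRY
    refine le_level h1 (fun k hk => ?_) ht hRY ?_
    · rw [Finset.mem_Icc] at hk
      exact hμpos k hk.1 (by omega)
    · rw [← hrate]
      exact Finset.sum_le_sum_of_subset_of_nonneg (Finset.Icc_subset_Icc_right (by omega))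
        fun k _ _ => hnn _
  -- All the rate is spent on the first `r₀` components, where scaling both spectrum and level by
  -- `c` leaves the ratios unchanged.
  have hactive : ∑ l ∈ Finset.Icc 1 r₀, 1 / 2 * Real.logb 2 (max 1 (ν l / (c * t))) = R := by
    rw [← hrate, ← Finset.sum_subset (Finset.Icc_subset_Icc_right (by omega : r₀ ≤ L))]
    · refine Finset.sum_congr rfl fun l hl => ?_
      rw [hνμ l hl, mul_div_mul_left _ _ hc0.ne']
    · intro l hl hl'
      simp only [Finset.mem_Icc] at hl hl'
      rw [max_eq_left ((div_le_one ht).2 (hμle l (by omega) hl.2)), Real.logb_one, mul_zero]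
  have hνle : ∀ l, r₀ < l → l ≤ min L M → ν l ≤ c * t := fun l hl hlm => by
    refine (eig_le_eig (covEst_isHermitian A) (by omega : 1 ≤ r₀ + 1) hl (by omega)).trans ?_
    rw [rateThreshold_eq (by rw [rank_covEst A hA hσ]; omega)
      (hνpos 1 le_rfl (by omega)).ne', EReal.coe_le_coe_iff] at hRE
    refine le_level h1 (fun k hk => ?_) hct hRE hactive.le
    rw [Finset.mem_Icc] at hk
    exact hνpos k hk.1 (by omega)
  -- Each admissible law is bounded below at level `c θ`. What remains is that the upper bound does
  -- not exceed this lower bound and that the level costs at least `R`.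
  refine le_iInf₂ fun ρ hρ => hce.trans (le_trans ?_ (le_distortion A hσ hct ?_ hρ.1 hρ.2))
  · gcongr
    rw [← sum_eig (covY_isHermitian A σ) (fun x => (x - σ ^ 2) / x ^ 2 * min x t),
      ← sum_eig (covEst_isHermitian A) (fun x => min x (c * t)), ← hμ, ← hν,
      ← Finset.sum_subset (Finset.Icc_subset_Icc_right (by omega : min L M ≤ L))]
    · refine (Finset.sum_le_sum fun l hl => ?_).trans
        (Finset.sum_le_sum_of_subset_of_nonneg
          (Finset.Icc_subset_Icc_right (by omega : min L M ≤ M)) fun l hl _ => ?_)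
      · rw [Finset.mem_Icc] at hl
        have hsl : μ l = spec A l + σ ^ 2 := eig_covY A hl.1 (by omega)
        have hμl := hμpos l hl.1 (by omega)
        by_cases hlr : l ≤ r₀
        · have hl' : l ∈ Finset.Icc 1 r₀ := Finset.mem_Icc.2 ⟨hl.1, hlr⟩
          have : (μ l - σ ^ 2) / μ l ^ 2 = c := by
            rw [hsl, add_sub_cancel_right, hratio l hl']
          rw [this, hνμ l hl', mul_min_of_nonneg _ _ hc0.le]
        · have hνl : ν l = spec A l / (spec A l + σ ^ 2) := eig_covEst A hA hσ hl.1 (by omega)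
          -- Under water, both sums contribute `(μ - σ²) / μ = ν`.
          rw [min_eq_left (hμle l (by omega) (by omega)), min_eq_left (hνle l (by omega) hl.2),
            hνl, ← hsl]
          have : spec A l = μ l - σ ^ 2 := by rw [hsl, add_sub_cancel_right]
          rw [this]
          apply le_of_eq
          field_simp
      · rw [Finset.mem_Icc] at hl
        refine le_min ?_ hct.le
        have hνl : ν l = spec A l / (spec A l + σ ^ 2) := eig_covEst A hA hσ hl.1 hl.2
        have := spec_nonneg A l
        rw [hνl]
        positivity
    -- Components beyond `min L M` are pure noise: `μ_l = σ²`, so their weight is zero.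
    · intro l hl hl'
      simp only [Finset.mem_Icc] at hl hl'
      have hsl : μ l = spec A l + σ ^ 2 := eig_covY A hl.1 hl.2
      rw [hsl, spec_eq_zero A hA hl.1 (by omega)]
      simp
  · have h2 : Real.log 2 ≠ 0 := (Real.log_pos one_lt_two).ne'
    have hlog : ∀ x : ℝ, 1 / 2 * Real.log x = 1 / 2 * Real.logb 2 x * Real.log 2 := fun x => by
      rw [Real.logb, mul_assoc, div_mul_cancel₀ _ h2]
    rw [← sum_eig (covEst_isHermitian A) (fun x => 1 / 2 * Real.log (max 1 (x / (c * t))))]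
    simp_rw [hlog]
    rw [← Finset.sum_mul]
    refine mul_le_mul_of_nonneg_right ?_ (Real.log_pos one_lt_two).le
    rw [← hactive]
    exact Finset.sum_le_sum_of_subset_of_nonneg (Finset.Icc_subset_Icc_right (by omega))
      fun k _ _ => hnn _

lemma iDRFExpr_eq_ceDRFExpr (hL : 0 < L) (hA : A.rank = min L M) (hσ : 0 < σ)
    (h1 : 1 ≤ r₀) (hr : r₀ ≤ min L M)
    (hratio : ∀ l ∈ Finset.Icc 1 r₀,
      spec A l / (spec A l + σ ^ 2) ^ 2 = spec A 1 / (spec A 1 + σ ^ 2) ^ 2)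
    {R : ℝ} (hRY : (R : EReal) ≤ rateThreshold (covY A σ) (r₀ + 1))
    (hRE : (R : EReal) ≤ rateThreshold (covEst A σ) (r₀ + 1))
    {kI kCE : ℕ} (hkI1 : 1 ≤ kI) (hkI : kI ≤ min L M) (hkCE1 : 1 ≤ kCE) (hkCE : kCE ≤ L)
    (hI : rateThreshold (covEst A σ) kI < (R : EReal))
    (hI' : (R : EReal) ≤ rateThreshold (covEst A σ) (kI + 1))
    (hCE : rateThreshold (covY A σ) kCE < (R : EReal))
    (hCE' : (R : EReal) ≤ rateThreshold (covY A σ) (kCE + 1)) :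
    iDRFExpr A σ kI R = ceDRFExpr A σ kCE R := by
  set c := spec A 1 / (spec A 1 + σ ^ 2) ^ 2 with hc
  have hs : 0 < spec A 1 := (spec_pos_iff A hA le_rfl).2 (by omega)
  have hc0 : 0 < c := by positivity
  have hμpos : ∀ l, 1 ≤ l → l ≤ L → 0 < eig (covY A σ) l := fun l h h' => eig_covY_pos A hσ h h'
  have hνpos : ∀ l, 1 ≤ l → l ≤ min L M → 0 < eig (covEst A σ) l :=
    fun l h h' => eig_covEst_pos A hA hσ h h'
  have hνμ : ∀ l ∈ Finset.Icc 1 r₀, eig (covEst A σ) l = c * eig (covY A σ) l := fun l hl => by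
    have hl' := Finset.mem_Icc.1 hl
    exact eig_covEst_eq_mul A hA hσ hl'.1 (by omega) (hratio l hl)
  have hTY : ∀ k, k ≤ L → rateThreshold (covY A σ) k =
      ((1 / 2 * ∑ l ∈ Finset.Icc 1 k,
        Real.logb 2 (eig (covY A σ) l / eig (covY A σ) k) : ℝ) : EReal) := fun k hk =>
    rateThreshold_eq (by rwa [rank_covY A hσ]) (hμpos 1 le_rfl hL).ne'
  have hTE : ∀ k, k ≤ min L M → rateThreshold (covEst A σ) k =
      ((1 / 2 * ∑ l ∈ Finset.Icc 1 k,
        Real.logb 2 (eig (covEst A σ) l / eig (covEst A σ) k) : ℝ) : EReal) := fun k hk =>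
    rateThreshold_eq (by rwa [rank_covEst A hA hσ]) (hνpos 1 le_rfl (by omega)).ne'
  have hmonoY : ∀ k k', 1 ≤ k → k ≤ k' → k' ≤ L →
      rateThreshold (covY A σ) k ≤ rateThreshold (covY A σ) k' := fun k k' hk hkk hk' => by
    rw [hTY k (by omega), hTY k' hk', EReal.coe_le_coe_iff]
    refine threshold_mono hk hkk (fun l hl => ?_) fun i j hi hij hj =>
      eig_le_eig (covY_isHermitian A σ) hi hij (by omega)
    rw [Finset.mem_Icc] at hl
    exact hμpos l hl.1 (by omega)
  have hmonoE : ∀ k k', 1 ≤ k → k ≤ k' → k' ≤ min L M →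
      rateThreshold (covEst A σ) k ≤ rateThreshold (covEst A σ) k' := fun k k' hk hkk hk' => by
    rw [hTE k (by omega), hTE k' hk', EReal.coe_le_coe_iff]
    refine threshold_mono hk hkk (fun l hl => ?_) fun i j hi hij hj =>
      eig_le_eig (covEst_isHermitian A) hi hij (by omega)
    rw [Finset.mem_Icc] at hl
    exact hνpos l hl.1 (by omega)
  -- An active index beyond `r₀` would, by monotonicity, have a threshold at least that of `r₀ + 1`,
  -- hence at least `R`.
  have hCEr : kCE ≤ r₀ := by
    by_contra h
    exact ((hRY.trans (hmonoY (r₀ + 1) kCE (by omega) (by omega) hkCE)).trans_lt hCE).false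
  have hIr : kI ≤ r₀ := by
    by_contra h
    exact ((hRE.trans (hmonoE (r₀ + 1) kI (by omega) (by omega) hkI)).trans_lt hI).false
  have hTeq : ∀ k, 1 ≤ k → k ≤ r₀ →
      rateThreshold (covEst A σ) k = rateThreshold (covY A σ) k := fun k hk hkr => by
    rw [hTE k (by omega), hTY k (by omega)]
    congr 2
    refine Finset.sum_congr rfl fun l hl => ?_
    rw [Finset.mem_Icc] at hl
    rw [hνμ l (Finset.mem_Icc.2 ⟨hl.1, by omega⟩), hνμ k (Finset.mem_Icc.2 ⟨hk, hkr⟩),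
      mul_div_mul_left _ _ hc0.ne']
  have hk : kI = kCE := by
    rcases lt_trichotomy kI kCE with h | h | h
    · rw [hTeq (kI + 1) (by omega) (by omega)] at hI'
      exact ((hI'.trans (hmonoY (kI + 1) kCE (by omega) h hkCE)).trans_lt hCE).false.elim
    · exact h
    · rw [← hTeq (kCE + 1) (by omega) (by omega)] at hCE'
      exact ((hCE'.trans (hmonoE (kCE + 1) kI (by omega) h hkI)).trans_lt hI).false.elim
  subst hk
  have hkR : (kI : ℝ) ≠ 0 := by positivity
  have hsum : ∑ l ∈ Finset.Icc 1 kI, spec A l / (spec A l + σ ^ 2) ^ 2 = kI * c := by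
    rw [Finset.sum_congr rfl (g := fun _ => c)]
    · simp
    · intro l hl
      rw [Finset.mem_Icc] at hl
      exact hratio l (Finset.mem_Icc.2 ⟨hl.1, by omega⟩)
  have hprod : ∏ l ∈ Finset.Icc 1 kI, eig (covEst A σ) l =
      c ^ kI * ∏ l ∈ Finset.Icc 1 kI, eig (covY A σ) l := by
    rw [Finset.prod_congr rfl (g := fun l => c * eig (covY A σ) l), Finset.prod_mul_distrib]
    · simp
    · intro l hl
      rw [Finset.mem_Icc] at hl
      exact hνμ l (Finset.mem_Icc.2 ⟨hl.1, by omega⟩)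
  -- The geometric mean of `kI` eigenvalues, each scaled by `c`, scales by `c`.
  have htheta : thetaLevel (covEst A σ) kI R = c * thetaLevel (covY A σ) kI R := by
    rw [thetaLevel, thetaLevel, hprod, Real.mul_rpow (by positivity), ← Real.rpow_natCast,
      ← Real.rpow_mul hc0.le, mul_one_div_cancel hkR, Real.rpow_one]
    · ring
    · refine Finset.prod_nonneg fun l hl => ?_
      rw [Finset.mem_Icc] at hl
      exact (hμpos l hl.1 (by omega)).le
  rw [iDRFExpr, ceDRFExpr, htheta, hsum]
  ring

end SmallRates

/-- The equation `x / (x + s)² = c` for `c` in the range of the left-hand side. -/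
lemma div_add_sq_eq_iff {s x c : ℝ} (hs : 0 < s) (hx : 0 ≤ x) (hc : 0 < c) (hcs : 4 * c * s ≤ 1) :
    x / (x + s) ^ 2 = c ↔
      x = (1 - 2 * c * s + √(1 - 4 * c * s)) / (2 * c) ∨
      x = (1 - 2 * c * s - √(1 - 4 * c * s)) / (2 * c) := by
  have hq : 0 ≤ 1 - 4 * c * s := by linarith
  have hsq := Real.mul_self_sqrt hq
  have hxs : x + s ≠ 0 := by positivity
  -- After clearing the denominator the equation is `c x² + (2 c s - 1) x + c s² = 0`.
  have hdisc : discrim c (2 * c * s - 1) (c * s ^ 2) = √(1 - 4 * c * s) * √(1 - 4 * c * s) := by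
    rw [hsq, discrim]
    ring
  have := quadratic_eq_zero_iff hc.ne' hdisc x
  rw [div_eq_iff (by positivity)]
  rw [show -(2 * c * s - 1) = 1 - 2 * c * s by ring] at this
  rw [← this]
  constructor <;> intro h <;> linarith

end RemoteSource

theorem proposition3 (L M : ℕ) (hL : 0 < L) (hM : 0 < M)
    (A : Matrix (Fin L) (Fin M) ℝ) (hA : A.rank = min L M) (σ : ℝ) (hσ : 0 < σ)
    (r₀ : ℕ)
    (hr₀ : IsGreatest {k : ℕ | k ∈ Finset.Icc 1 L ∧ ∀ l ∈ Finset.Icc 1 k,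
      spec A l / (spec A l + σ ^ 2) ^ 2 = spec A 1 / (spec A 1 + σ ^ 2) ^ 2} r₀) :
    -- the two descriptions of the components with the same ratio as the first one agree
    (∀ c : ℝ, c = spec A 1 / (spec A 1 + σ ^ 2) ^ 2 → ∀ k ∈ Finset.Icc 1 L,
      (spec A k / (spec A k + σ ^ 2) ^ 2 = c ↔
        spec A k = (1 - 2 * c * σ ^ 2 + √(1 - 4 * c * σ ^ 2)) / (2 * c) ∨
        spec A k = (1 - 2 * c * σ ^ 2 - √(1 - 4 * c * σ ^ 2)) / (2 * c))) ∧
    -- equality of the two distortion-rate functions at small rates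
    (∀ R : ℝ, 0 ≤ R →
      (R : EReal) ≤ min (rateThreshold (covY A σ) (r₀ + 1)) (rateThreshold (covEst A σ) (r₀ + 1)) →
      ceDRF A σ R = iDRF A σ R) ∧
    -- equality of their closed forms at small rates
    (∀ R : ℝ, 0 ≤ R →
      (R : EReal) ≤ min (rateThreshold (covY A σ) (r₀ + 1)) (rateThreshold (covEst A σ) (r₀ + 1)) →
      ∀ kI ∈ Finset.Icc 1 (min L M), ∀ kCE ∈ Finset.Icc 1 L,
        rateThreshold (covEst A σ) kI < (R : EReal) →
        (R : EReal) ≤ rateThreshold (covEst A σ) (kI + 1) →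
        rateThreshold (covY A σ) kCE < (R : EReal) →
        (R : EReal) ≤ rateThreshold (covY A σ) (kCE + 1) →
        iDRFExpr A σ kI R = ceDRFExpr A σ kCE R) ∧
    -- equality at all rates
    (r₀ = L → L = M → ∀ R : ℝ, 0 ≤ R → ceDRF A σ R = iDRF A σ R) ∧
    -- compress-and-estimate is never better than the optimum
    (∀ R : ℝ, 0 ≤ R → iDRF A σ R ≤ ceDRF A σ R) := by
  have hσ2 : 0 < σ ^ 2 := by positivity
  have hs : 0 < spec A 1 := (spec_pos_iff A hA le_rfl).2 (by omega)
  obtain ⟨hr1, hrL⟩ := Finset.mem_Icc.1 hr₀.1.1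
  have hratio := hr₀.1.2
  have hr : r₀ ≤ min L M :=
    le_min_of_ratio_eq A hL hM hA hσ hr1 (hratio r₀ (Finset.mem_Icc.2 ⟨hr1, le_rfl⟩))
  refine ⟨?_, ?_, ?_, ?_, fun R hR => iDRF_le_ceDRF A hL hσ hR⟩
  · rintro c rfl k -
    refine div_add_sq_eq_iff hσ2 (spec_nonneg A k) (by positivity) ?_
    have : 4 * (spec A 1 / (spec A 1 + σ ^ 2) ^ 2) * σ ^ 2
        = 4 * spec A 1 * σ ^ 2 / (spec A 1 + σ ^ 2) ^ 2 := by ring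
    rw [this, div_le_one (by positivity)]
    -- The discriminant is nonnegative because `4 λ σ² ≤ (λ + σ²)²`.
    nlinarith [sq_nonneg (spec A 1 - σ ^ 2)]
  · intro R hR hRle
    obtain ⟨hRY, hRE⟩ := le_min_iff.1 hRle
    exact ceDRF_eq_iDRF A hL hA hσ hr1 hr hratio hR hRY hRE
  · intro R _ hRle kI hkI kCE hkCE hI hI' hCE hCE'
    obtain ⟨hRY, hRE⟩ := le_min_iff.1 hRle
    obtain ⟨hkI1, hkI⟩ := Finset.mem_Icc.1 hkI
    obtain ⟨hkCE1, hkCE⟩ := Finset.mem_Icc.1 hkCE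
    exact iDRFExpr_eq_ceDRFExpr A hL hA hσ hr1 hr hratio hRY hRE hkI1 hkI hkCE1 hkCE
      hI hI' hCE hCE'
  · intro hrL' hLM R hR
    -- When `r₀ = L = M` both ranks equal `r₀`, so both thresholds at `r₀ + 1` are infinite and the
    -- small-rate case covers all rates.
    have htop : ∀ {n : ℕ} (C : Matrix (Fin n) (Fin n) ℝ), C.rank ≤ r₀ →
        (R : EReal) ≤ rateThreshold C (r₀ + 1) := fun C hC => by
      rw [rateThreshold, if_neg (by omega), if_neg (by omega)]
      exact le_top
    exact ceDRF_eq_iDRF A hL hA hσ hr1 hr hratio hR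
      (htop _ (by rw [rank_covY A hσ]; omega)) (htop _ (by rw [rank_covEst A hA hσ]; omega))
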